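/- Let $\Theta\subseteq\mathbb R$ be a set of parameters and let $\delta$ be fixed. For every $\theta\in\Theta$ let $\psi_\theta:[0,\infty)\to(0,1]$ be the Laplace transform of a positive random variable, and let $K_\delta(u,v)=\phi_\delta(\phi_\delta^{-1}(u)+\phi_\delta^{-1}(v))$ be an Archimedean copula with generator $\phi_\delta:[0,\infty)\to(0,1]$, that is, $\phi_\delta$ is continuous and strictly convex with $\phi_\delta(0)=1$ and $\lim_{s\to\infty}\phi_\delta(s)=0$. Let $$C_{\theta,\delta}(u,v)=\psi_\theta\bigl(-\log K_\delta(e^{-\psi_\theta^{-1}(u)},e^{-\psi_\theta^{-1}(v)})\bigr)$$ (read as $0$ if $u=0$ or $v=0$) be a copula for every $\theta\in\Theta$, and let $\eta_{\theta,\delta}(s)=\psi_\theta(-\log\phi_\delta(s))$ be its associated generator. Suppose that, for every $\theta\in\Theta$, $\eta_{\theta,\delta}$ is completely monotone on $[0,\infty)$ (continuous on $[0,\infty)$, smooth on $(0,\infty)$, and $(-1)^n\eta_{\theta,\delta}^{(n)}\ge 0$ on $(0,\infty)$ for all $n\ge 0$) with $\eta_{\theta,\delta}(0)=1$. Suppose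 also that $C_{\theta,\delta}$ is increasing in $\theta$ in the supermodular order: whenever $\theta_1\le\theta_2$ in $\Theta$, $X\sim C_{\theta_1,\delta}$ and $X'\sim C_{\theta_2,\delta}$, one has $\mathbb E\,\Psi(X)\le\mathbb E\,\Psi(X')$ for every $\Psi:\mathbb R^2\to\mathbb R$ with $\Psi(x)+\Psi(y)\le\Psi(x\vee y)+\Psi(x\wedge y)$ for all $x,y\in\mathbb R^2$ (coordinatewise maximum and minimum) for which both expectations exist and are finite. Then the negative copula entropy $$-H(C_{\theta,\delta})=\int_{[0,1]^2}c_{\theta,\delta}(u,v)\log c_{\theta,\delta}(u,v)\,du\,dv\in[0,\infty],$$ where $c_{\theta,\delta}$ is the density of $C_{\theta,\delta}$ (and $-H=+\infty$ by convention for a law without a density), is nondecreasing in $\theta\in\Theta$: if $\theta_1\le\theta_2$ in $\Theta$, then $-H(C_{\theta_1,\delta})\le -H(C_{\theta_2,\delta})$. -/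

import Mathlib

open Set Filter Topology MeasureTheory
open scoped ENNReal ContDiff

/-- `ψ` is, on `[0, ∞)`, the Laplace transform of the law `M` of a positive random variable. -/
def IsLaplaceTransform (ψ : ℝ → ℝ) : Prop :=
  ∃ M : Measure ℝ, IsProbabilityMeasure M ∧ M (Iic 0) = 0 ∧
    ∀ s : ℝ, 0 ≤ s → ψ s = ∫ a, Real.exp (-(s * a)) ∂M

/-- Complete monotonicity on `[0, ∞)`: continuous there, smooth on `(0, ∞)`, and the derivatives
of all orders alternate in sign. -/
structure IsCompletelyMonotone (f : ℝ → ℝ) : Prop where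
  continuousOn : ContinuousOn f (Ici 0)
  contDiffOn : ContDiffOn ℝ ∞ f (Ioi 0)
  alternating : ∀ (n : ℕ) (x : ℝ), 0 < x → 0 ≤ (-1 : ℝ) ^ n * iteratedDerivWithin n f (Ioi 0) x

/-- Generators of bivariate Archimedean copulas (only the values on `[0, ∞)` matter). Such a
function is a bijection of `[0, ∞)` onto `(0, 1]`. -/
structure IsArchimedeanGenerator (φ : ℝ → ℝ) : Prop where
  continuousOn : ContinuousOn φ (Ici 0)
  strictConvexOn : StrictConvexOn ℝ (Ici 0) φ
  nonneg : ∀ s : ℝ, 0 ≤ s → 0 ≤ φ s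
  map_zero : φ 0 = 1
  tendsto_zero : Tendsto φ atTop (𝓝 0)

/-- The inverse of a generator, regarded as a function on `[0, ∞)`; it is used at `u ∈ (0, 1]`. -/
noncomputable def generatorInv (φ : ℝ → ℝ) (u : ℝ) : ℝ :=
  Function.invFunOn φ (Ici 0) u

open Classical in
/-- The Archimedean copula `φ (φ⁻¹ u + φ⁻¹ v)`. On the edges `u = 0` and `v = 0` of the unit
square, where `φ⁻¹` is infinite, its value is `0`. -/
noncomputable def archimedeanCopula (φ : ℝ → ℝ) (u v : ℝ) : ℝ :=
  if 0 < u ∧ 0 < v then φ (generatorInv φ u + generatorInv φ v) else 0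

open Classical in
/-- The copula `ψ (-log K (exp (-ψ⁻¹ u), exp (-ψ⁻¹ v)))`, where `K` is the Archimedean copula
with generator `φ`. On the edges `u = 0` and `v = 0` of the unit square its value is `0`. -/
noncomputable def twoParameterCopula (ψ φ : ℝ → ℝ) (u v : ℝ) : ℝ :=
  if 0 < u ∧ 0 < v then
    ψ (-Real.log (archimedeanCopula φ (Real.exp (-generatorInv ψ u))
      (Real.exp (-generatorInv ψ v))))
  else 0

/-- The generator `η s = ψ (-log φ s)` of `twoParameterCopula ψ φ`. -/
noncomputable def twoParameterGenerator (ψ φ : ℝ → ℝ) (s : ℝ) : ℝ :=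
  ψ (-Real.log (φ s))

/-- `C`, on the unit square, is a copula, and `μ` is the law with distribution function `C`:
both marginals of `μ` are uniform on `[0, 1]`, so that `μ` is a probability measure. -/
structure IsCopulaLaw (C : ℝ → ℝ → ℝ) (μ : Measure (ℝ × ℝ)) : Prop where
  map_fst : μ.map Prod.fst = volume.restrict (Icc (0 : ℝ) 1)
  map_snd : μ.map Prod.snd = volume.restrict (Icc (0 : ℝ) 1)
  cdf_eq : ∀ u ∈ Icc (0 : ℝ) 1, ∀ v ∈ Icc (0 : ℝ) 1, μ.real (Iic u ×ˢ Iic v) = C u v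

/-- Supermodular functions on the plane, with its coordinatewise lattice operations. -/
def Supermodular (Ψ : ℝ × ℝ → ℝ) : Prop :=
  ∀ x y : ℝ × ℝ, Ψ x + Ψ y ≤ Ψ (x ⊔ y) + Ψ (x ⊓ y)

/-- The supermodular order on laws of bivariate random vectors: the expectation of every
supermodular function that has both expectations increases. -/
def SMOrder (μ ν : Measure (ℝ × ℝ)) : Prop :=
  ∀ Ψ : ℝ × ℝ → ℝ, Supermodular Ψ → Integrable Ψ μ → Integrable Ψ ν →
    ∫ x, Ψ x ∂μ ≤ ∫ x, Ψ x ∂ν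

open Classical in
/-- The entropy `-∫ c log c` of a law with Lebesgue density `c`, as an extended real number (for a
law on the unit square the positive part of `-c log c` is bounded, so that the difference is not
`∞ - ∞`). A law without a density has entropy `-∞`. -/
noncomputable def copulaEntropy (μ : Measure (ℝ × ℝ)) : EReal :=
  if μ ≪ volume then
    ((∫⁻ x, ENNReal.ofReal (Real.negMulLog (μ.rnDeriv volume x).toReal) : ℝ≥0∞) : EReal) -
      ((∫⁻ x, ENNReal.ofReal (-Real.negMulLog (μ.rnDeriv volume x).toReal) : ℝ≥0∞) : EReal)
  else ⊥

/-! Let c₁, c₂ be the densities at θ₁ ≤ θ₂. If log c₁ is supermodular, the order gives E₁ log c₁ ≤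
E₂ log c₁, and Gibbs' inequality gives E₂ log c₁ ≤ E₂ log c₂. The two ends are the negative
entropies.

Complete monotonicity supplies the supermodularity. The copula is η(η⁻¹u + η⁻¹v), so its density is
η''(η⁻¹u + η⁻¹v) times a function of u times a function of v, and η'' is log-convex. Log-convexity
is obtained without Bernstein's representation, by a bootstrap that improves the constant in α f'² ≤
f f'' through 0, 1/2, 2/3, ... up to the limit 1 (`sq_le_of_mul_sq_le`, `sq_le_mul`).

As log c₁ need not be integrable under the second law, the comparison is made for c₁ averaged over
the cells of a grid. The logarithm of this average takes finitely many values, and its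
supermodularity is total positivity of rectangle masses (`mixedDifference_mul_le`,
`measureReal_rectangle_mul_le`). The averages tend to c₁ almost everywhere (`tendsto_gridDensity`),
and Fatou's lemma applies to the nonnegative integrand c log c + 1 - c (`uniformDivergence_le`).
Absolute continuity of the laws, from a local bound on the masses of balls, identifies the resulting
divergences with the negative entropies. -/

/-! ### Alternating sequences: positivity and log-convexity -/

/-- Functions on `(0, ∞)` that are nonnegative, each the negative of the derivative of its
predecessor. -/
structure IsAlternatingSequence (f : ℕ → ℝ → ℝ) : Prop where
  nonneg : ∀ (k : ℕ) (x : ℝ), 0 < x → 0 ≤ f k x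
  hasDerivAt : ∀ (k : ℕ) (x : ℝ), 0 < x → HasDerivAt (f k) (-f (k + 1) x) x

theorem antitoneOn_Ioi_of_hasDerivAt_nonpos {f f' : ℝ → ℝ}
    (hf : ∀ x, 0 < x → HasDerivAt f (f' x) x) (hf' : ∀ x, 0 < x → f' x ≤ 0) :
    AntitoneOn f (Ioi 0) := by
  refine antitoneOn_of_hasDerivWithinAt_nonpos (f' := f') (convex_Ioi 0)
    (fun x hx => (hf x hx).continuousAt.continuousWithinAt) ?_ ?_ <;> rw [interior_Ioi]
  · exact fun x hx => (hf x hx).hasDerivWithinAt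
  · exact fun x hx => hf' x hx

namespace IsAlternatingSequence

variable {f : ℕ → ℝ → ℝ}

theorem antitoneOn (h : IsAlternatingSequence f) (k : ℕ) : AntitoneOn (f k) (Ioi 0) :=
  antitoneOn_Ioi_of_hasDerivAt_nonpos (h.hasDerivAt k)
    fun x hx => neg_nonpos.2 (h.nonneg (k + 1) x hx)

theorem continuousAt (h : IsAlternatingSequence f) (k : ℕ) {x : ℝ} (hx : 0 < x) :
    ContinuousAt (f k) x :=
  (h.hasDerivAt k x hx).continuousAt

theorem exists_sub_eq (h : IsAlternatingSequence f) (k : ℕ) {x y : ℝ} (hx : 0 < x) (hxy : x < y) :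
    ∃ z ∈ Ioo x y, f k x - f k y = f (k + 1) z * (y - x) := by
  obtain ⟨z, hz, hz'⟩ := exists_hasDerivAt_eq_slope (f k) (fun x => -f (k + 1) x) hxy
    (fun t ht => (h.continuousAt k (hx.trans_le ht.1)).continuousWithinAt)
    (fun t ht => h.hasDerivAt k t (hx.trans ht.1))
  refine ⟨z, hz, ?_⟩
  have : y - x ≠ 0 := (sub_pos.2 hxy).ne'
  field_simp at hz'
  linarith

/-- By the mean value theorem on [x/2, x], (x/2) f (k+1) x is at most the drop of f k there, which
is bounded. -/
theorem tendsto_zero (h : IsAlternatingSequence f) (k : ℕ) :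
    Tendsto (f (k + 1)) atTop (𝓝 0) := by
  have key : ∀ x : ℝ, 2 ≤ x → f (k + 1) x ≤ f k 1 * 2 / x := by
    intro x hx
    obtain ⟨z, hz, he⟩ := h.exists_sub_eq k (x := x / 2) (y := x) (by linarith) (by linarith)
    have h1 : f (k + 1) x ≤ f (k + 1) z :=
      h.antitoneOn (k + 1) (show 0 < z by linarith [hz.1]) (show 0 < x by linarith) hz.2.le
    have h2 : f k (x / 2) ≤ f k 1 :=
      h.antitoneOn k (show (0 : ℝ) < 1 by norm_num) (show 0 < x / 2 by linarith) (by linarith)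
    have h3 := h.nonneg k x (by linarith)
    have h4 : f (k + 1) x * (x / 2) ≤ f (k + 1) z * (x / 2) := by gcongr
    rw [le_div_iff₀ (by linarith)]
    nlinarith
  refine squeeze_zero' ?_ ?_ (tendsto_const_nhds.div_atTop tendsto_id (a := f k 1 * 2))
  · filter_upwards [eventually_gt_atTop 0] with x hx using h.nonneg _ x hx
  · filter_upwards [eventually_ge_atTop 2] with x hx using key x hx

/-- A zero of f (k+1) persists to its right by monotonicity, so f k is constant there and equals its
limit 0, against the positivity of f k. -/
theorem pos (h : IsAlternatingSequence f) (h0 : ∀ x, 0 < x → 0 < f 0 x)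
    (hlim : Tendsto (f 0) atTop (𝓝 0)) (k : ℕ) : ∀ x, 0 < x → 0 < f k x := by
  induction k with
  | zero => exact h0
  | succ k ih =>
    intro x hx
    refine (h.nonneg _ x hx).lt_of_ne' fun he => (ih x hx).ne' ?_
    have hlim' : Tendsto (f k) atTop (𝓝 0) := by
      cases k with
      | zero => exact hlim
      | succ k => exact h.tendsto_zero k
    have hconst : ∀ y, x < y → f k y = f k x := by
      intro y hy
      obtain ⟨z, hz, hz'⟩ := h.exists_sub_eq k hx hy
      have h1 : f (k + 1) z ≤ f (k + 1) x := h.antitoneOn _ hx (hx.trans hz.1) hz.1.le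
      have h2 := h.nonneg (k + 1) z (hx.trans hz.1)
      have h3 : f (k + 1) z = 0 := le_antisymm (h1.trans he.le) h2
      rw [h3] at hz'
      linarith
    refine tendsto_nhds_unique (tendsto_const_nhds (x := f k x) (f := atTop (α := ℝ)))
      (hlim'.congr' ?_)
    filter_upwards [eventually_gt_atTop x] with y hy using hconst y hy

/-- One round of the bootstrap: the constant α for the pair of derivatives one order higher becomes
1 / (2 - α) here. The hypothesis says that f (k+1) ^ α / f (k+2) is nondecreasing; integrating the
resulting inequality from x to ∞ gives the claim. -/
theorem sq_le_of_mul_sq_le (h : IsAlternatingSequence f) (hpos : ∀ k x, 0 < x → 0 < f k x)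
    {k : ℕ} {α : ℝ} (hα : α ≤ 1)
    (hk : ∀ x, 0 < x → α * f (k + 2) x ^ 2 ≤ f (k + 1) x * f (k + 3) x) {x : ℝ} (hx : 0 < x) :
    f (k + 1) x ^ 2 ≤ (2 - α) * (f k x * f (k + 2) x) := by
  have hα2 : 0 < 2 - α := by linarith
  have hr : AntitoneOn (fun t => -(f (k + 1) t ^ α / f (k + 2) t)) (Ioi 0) := by
    refine antitoneOn_Ioi_of_hasDerivAt_nonpos (fun t ht =>
      ((((h.hasDerivAt (k + 1) t ht).rpow_const (p := α) (Or.inl (hpos _ t ht).ne')).div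
        (h.hasDerivAt (k + 2) t ht) (hpos _ t ht).ne').neg)) fun t ht => ?_
    have hg := hpos (k + 1) t ht
    have hg1 := hpos (k + 2) t ht
    rw [neg_nonpos]
    refine div_nonneg ?_ (sq_nonneg _)
    have e : f (k + 1) t ^ α = f (k + 1) t ^ (α - 1) * f (k + 1) t := by
      rw [← Real.rpow_add_one hg.ne']; ring_nf
    have h1 := hk t ht
    have h2 : 0 ≤ f (k + 1) t ^ (α - 1) := by positivity
    rw [e]
    have := mul_nonneg h2 (sub_nonneg.2 h1)
    calc 0 ≤ _ := this
      _ = _ := by ring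
  set r := f (k + 1) x ^ α / f (k + 2) x with hrdef
  have hr0 : 0 ≤ r := div_nonneg (Real.rpow_nonneg (hpos _ x hx).le _) (hpos _ x hx).le
  -- The derivative of G is r f (k+2) f (k+1) ^ (1 - α) - f (k+1), nonpositive on [x, ∞) by the
  -- monotonicity `hr`. As f k ≥ 0 and f (k+1) → 0, G stays nonnegative at x.
  set G : ℝ → ℝ := fun t => f k t - r / (2 - α) * f (k + 1) t ^ (2 - α) with hG
  have hGd : ∀ t, 0 < t → HasDerivAt G
      (-f (k + 1) t - r / (2 - α) * (-f (k + 2) t * (2 - α) * f (k + 1) t ^ (2 - α - 1))) t :=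
    fun t ht => (h.hasDerivAt k t ht).sub (((h.hasDerivAt (k + 1) t ht).rpow_const
      (Or.inl (hpos _ t ht).ne')).const_mul _)
  have hGanti : AntitoneOn G (Ici x) := by
    refine antitoneOn_of_hasDerivWithinAt_nonpos (convex_Ici x)
      (fun t ht => (hGd t (hx.trans_le ht)).continuousAt.continuousWithinAt)
      (fun t ht => (hGd t (hx.trans_le (interior_subset ht))).hasDerivWithinAt) fun t ht => ?_
    have ht' : x ≤ t := interior_subset ht
    have ht0 : 0 < t := hx.trans_le ht'
    have hg := hpos (k + 1) t ht0
    have hg1 := hpos (k + 2) t ht0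
    have h1 : r ≤ f (k + 1) t ^ α / f (k + 2) t := neg_le_neg_iff.1 (hr hx ht0 ht')
    have e : f (k + 1) t ^ α * f (k + 1) t ^ (2 - α - 1) = f (k + 1) t := by
      rw [← Real.rpow_add hg]; ring_nf; exact Real.rpow_one _
    have h2 : r * (f (k + 2) t * f (k + 1) t ^ (2 - α - 1)) ≤
        f (k + 1) t ^ α / f (k + 2) t * (f (k + 2) t * f (k + 1) t ^ (2 - α - 1)) := by
      gcongr
    have h3 : f (k + 1) t ^ α / f (k + 2) t * (f (k + 2) t * f (k + 1) t ^ (2 - α - 1)) =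
        f (k + 1) t := by
      rw [← mul_assoc, div_mul_cancel₀ _ hg1.ne', e]
    have h4 : r / (2 - α) * (-f (k + 2) t * (2 - α) * f (k + 1) t ^ (2 - α - 1)) =
        -(r * (f (k + 2) t * f (k + 1) t ^ (2 - α - 1))) := by
      field_simp
    rw [h4]
    linarith
  have hlim : Tendsto (fun t => -(r / (2 - α) * f (k + 1) t ^ (2 - α))) atTop (𝓝 0) := by
    have h1 := (h.tendsto_zero k).rpow_const (p := 2 - α) (Or.inr hα2.le)
    rw [Real.zero_rpow hα2.ne'] at h1
    simpa using (h1.const_mul (r / (2 - α))).neg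
  have hGx : 0 ≤ G x := by
    refine le_of_tendsto hlim ?_
    filter_upwards [eventually_ge_atTop x] with t ht
    have h1 := hGanti (mem_Ici.2 le_rfl) (mem_Ici.2 ht) ht
    have h2 := h.nonneg k t (hx.trans_le ht)
    simp only [hG] at h1 ⊢
    linarith
  have hg := hpos (k + 1) x hx
  have hg1 := hpos (k + 2) x hx
  have e : f (k + 1) x ^ α * f (k + 1) x ^ (2 - α) = f (k + 1) x ^ 2 := by
    rw [← Real.rpow_add hg, ← Real.rpow_natCast]; norm_num
  have h5 : r / (2 - α) * f (k + 1) x ^ (2 - α) ≤ f k x := by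
    simpa [hG] using hGx
  have h6 : r / (2 - α) * f (k + 1) x ^ (2 - α) =
      f (k + 1) x ^ 2 / ((2 - α) * f (k + 2) x) := by
    rw [← e, hrdef]; field_simp
  rw [h6, div_le_iff₀ (by positivity)] at h5
  linarith

/-- The terms of a positive alternating sequence are log-convex. -/
theorem sq_le_mul (h : IsAlternatingSequence f) (hpos : ∀ k x, 0 < x → 0 < f k x)
    (k : ℕ) {x : ℝ} (hx : 0 < x) : f (k + 1) x ^ 2 ≤ f k x * f (k + 2) x := by
  -- The map α ↦ 1 / (2 - α) sends m / (m + 1) to (m + 1) / (m + 2); starting at 0 it tends to 1.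
  have key : ∀ (m k : ℕ) (x : ℝ), 0 < x →
      (m : ℝ) * f (k + 1) x ^ 2 ≤ (m + 1) * (f k x * f (k + 2) x) := by
    intro m
    induction m with
    | zero =>
      intro k x hx
      have := mul_pos (hpos k x hx) (hpos (k + 2) x hx)
      simpa using this.le
    | succ m ih =>
      intro k x hx
      have hm : (0 : ℝ) < m + 1 := by positivity
      have h1 := h.sq_le_of_mul_sq_le hpos (k := k) (α := m / (m + 1))
        (by rw [div_le_one hm]; linarith) (fun y hy => by
          rw [div_mul_eq_mul_div, div_le_iff₀ hm, mul_comm _ ((m : ℝ) + 1)]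
          exact ih (k + 1) y hy) hx
      have h2 : (2 - (m : ℝ) / (m + 1)) = (m + 2) / (m + 1) := by field_simp; ring
      rw [h2, div_mul_eq_mul_div, le_div_iff₀ hm] at h1
      push_cast
      linarith
  by_contra! hlt
  obtain ⟨m, hm⟩ := exists_nat_gt (f k x * f (k + 2) x / (f (k + 1) x ^ 2 - f k x * f (k + 2) x))
  rw [div_lt_iff₀ (sub_pos.2 hlt)] at hm
  have := key m k x hx
  linarith

/-- This is convexity of log (f k): its derivative -f (k+1) / f k is nondecreasing, hence so is t ↦
f k (t + s) / f k t for every s ≥ 0. -/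
theorem mul_le_mul_of_add_eq (h : IsAlternatingSequence f) (hpos : ∀ k x, 0 < x → 0 < f k x)
    (k : ℕ) {a b c d : ℝ} (ha : 0 < a) (hab : a ≤ b) (hac : a ≤ c) (hd : a + d = b + c) :
    f k b * f k c ≤ f k a * f k d := by
  have hratio : AntitoneOn (fun t => f (k + 1) t / f k t) (Ioi 0) := by
    refine antitoneOn_Ioi_of_hasDerivAt_nonpos (fun t ht =>
      (h.hasDerivAt (k + 1) t ht).div (h.hasDerivAt k t ht) (hpos k t ht).ne') fun t ht => ?_
    refine div_nonpos_of_nonpos_of_nonneg ?_ (sq_nonneg _)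
    have := h.sq_le_mul hpos k ht
    simp only [add_assoc, Nat.reduceAdd]
    nlinarith
  have hs : 0 ≤ c - a := sub_nonneg.2 hac
  have hquot : AntitoneOn (fun t => -(f k (t + (c - a)) / f k t)) (Ioi 0) := by
    refine antitoneOn_Ioi_of_hasDerivAt_nonpos (fun t ht =>
      ((((h.hasDerivAt k (t + (c - a)) (by linarith)).comp_add_const t (c - a)).div
        (h.hasDerivAt k t ht) (hpos k t ht).ne').neg)) fun t ht => ?_
    rw [neg_nonpos]
    refine div_nonneg ?_ (sq_nonneg _)
    have ht' : 0 < t + (c - a) := by linarith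
    have h1 : f (k + 1) (t + (c - a)) / f k (t + (c - a)) ≤ f (k + 1) t / f k t :=
      hratio ht ht' (by linarith)
    rw [div_le_div_iff₀ (hpos k _ ht') (hpos k t ht)] at h1
    linarith
  have h1 : f k (a + (c - a)) / f k a ≤ f k (b + (c - a)) / f k b :=
    neg_le_neg_iff.1 (hquot ha (show 0 < b by linarith) hab)
  rw [div_le_div_iff₀ (hpos k a ha) (hpos k b (by linarith)), show a + (c - a) = c by ring,
    show b + (c - a) = d by linarith] at h1
  linarith

end IsAlternatingSequence

/-! ### Mixed differences and their total positivity -/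

/-- The mixed second difference of `(x, y) ↦ F (x + y)` over a rectangle. -/
def mixedDifference (F : ℝ → ℝ) (x x' y y' : ℝ) : ℝ :=
  F (x + y) - F (x' + y) - F (x + y') + F (x' + y')

/-- Transfers a comparison of ratios, with a / a' = p / p' and b / b' = q / q', in a form free of
division. -/
theorem mul_le_mul_of_mul_eq_mul {a a' b b' p p' q q' : ℝ} (ha : 0 ≤ a) (hb' : 0 ≤ b')
    (hp : 0 < p) (hq' : 0 < q') (h1 : a * p' = a' * p) (h2 : b * q' = b' * q)
    (h3 : q * p' ≤ p * q') : a' * b ≤ a * b' := by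
  refine le_of_mul_le_mul_right ?_ (mul_pos hp hq')
  calc a' * b * (p * q') = (a' * p) * (b * q') := by ring
    _ = (a * b') * (q * p') := by rw [← h1, h2]; ring
    _ ≤ (a * b') * (p * q') := by gcongr

namespace IsAlternatingSequence

variable {f : ℕ → ℝ → ℝ}

theorem continuousOn_sub_comp_add (hc : ContinuousOn (f 0) (Ici 0)) {x x' y y' : ℝ}
    (hx : 0 ≤ x) (hxx : x < x') (hy : 0 ≤ y) :
    ContinuousOn (fun t => f 0 (x + t) - f 0 (x' + t)) (Icc y y') := by
  refine ContinuousOn.sub ?_ ?_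
  · exact hc.comp (by fun_prop) fun t ht => show 0 ≤ x + t by linarith [ht.1]
  · exact hc.comp (by fun_prop) fun t ht => show 0 ≤ x' + t by linarith [ht.1]

theorem hasDerivAt_sub_comp_add (h : IsAlternatingSequence f) {x x' t : ℝ}
    (hx : 0 ≤ x) (hxx : x < x') (ht : 0 < t) :
    HasDerivAt (fun t => f 0 (x + t) - f 0 (x' + t)) (-(f 1 (x + t) - f 1 (x' + t))) t := by
  have h1 := ((h.hasDerivAt 0 (x + t) (by linarith)).comp_const_add x t).sub
    ((h.hasDerivAt 0 (x' + t) (by linarith)).comp_const_add x' t)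
  exact h1.congr_deriv (by ring_nf)

theorem exists_mixedDifference_eq (h : IsAlternatingSequence f)
    (hc : ContinuousOn (f 0) (Ici 0)) {x x' y y' : ℝ} (hx : 0 ≤ x) (hxx : x < x')
    (hy : 0 ≤ y) (hyy : y < y') :
    ∃ z ∈ Ioo x x', ∃ t ∈ Ioo y y',
      mixedDifference (f 0) x x' y y' = f 2 (z + t) * (x' - x) * (y' - y) := by
  obtain ⟨t, ht, he⟩ := exists_hasDerivAt_eq_slope _ _ hyy
    (continuousOn_sub_comp_add hc hx hxx hy)
    (fun t ht => h.hasDerivAt_sub_comp_add hx hxx (hy.trans_lt ht.1))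
  obtain ⟨w, hw, he'⟩ := h.exists_sub_eq 1 (x := x + t) (y := x' + t) (by linarith [ht.1])
    (by linarith)
  refine ⟨w - t, ⟨by linarith [hw.1], by linarith [hw.2]⟩, t, ht, ?_⟩
  rw [eq_div_iff (sub_pos.2 hyy).ne', he'] at he
  rw [sub_add_cancel, mixedDifference]
  norm_num at he ⊢
  linarith

theorem mixedDifference_pos (h : IsAlternatingSequence f) (hpos : ∀ k x, 0 < x → 0 < f k x)
    (hc : ContinuousOn (f 0) (Ici 0)) {x x' y y' : ℝ} (hx : 0 ≤ x) (hxx : x < x')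
    (hy : 0 ≤ y) (hyy : y < y') : 0 < mixedDifference (f 0) x x' y y' := by
  obtain ⟨z, hz, t, ht, he⟩ := h.exists_mixedDifference_eq hc hx hxx hy hyy
  rw [he]
  have := hpos 2 (z + t) (by linarith [hz.1, ht.1])
  have h1 := sub_pos.2 hxx
  have h2 := sub_pos.2 hyy
  positivity

/-- Total positivity of order two of the mixed differences. -/
theorem mixedDifference_mul_le (h : IsAlternatingSequence f)
    (hpos : ∀ k x, 0 < x → 0 < f k x) (hc : ContinuousOn (f 0) (Ici 0))
    {x₁ x₂ x₃ x₄ y₁ y₂ y₃ y₄ : ℝ} (hx₁ : 0 ≤ x₁) (hx₁₂ : x₁ < x₂) (hx₂₃ : x₂ ≤ x₃)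
    (hx₃₄ : x₃ < x₄) (hy₁ : 0 ≤ y₁) (hy₁₂ : y₁ < y₂) (hy₂₃ : y₂ ≤ y₃) (hy₃₄ : y₃ < y₄) :
    mixedDifference (f 0) x₃ x₄ y₁ y₂ * mixedDifference (f 0) x₁ x₂ y₃ y₄ ≤
      mixedDifference (f 0) x₁ x₂ y₁ y₂ * mixedDifference (f 0) x₃ x₄ y₃ y₄ := by
  have hx₃ : 0 ≤ x₃ := by linarith
  have hy₃ : 0 ≤ y₃ := by linarith
  -- Cauchy's mean value theorem in y replaces the ratio of the masses over the two x-intervals by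
  -- the ratio of x-increments of f 1 at one height, s for the lower y-interval and t for the upper
  -- one.
  obtain ⟨s, hs, es⟩ := exists_ratio_hasDerivAt_eq_ratio_slope _ _ hy₁₂
    (continuousOn_sub_comp_add hc hx₁ hx₁₂ hy₁)
    (fun t ht => h.hasDerivAt_sub_comp_add hx₁ hx₁₂ (hy₁.trans_lt ht.1)) _ _
    (continuousOn_sub_comp_add hc hx₃ hx₃₄ hy₁)
    (fun t ht => h.hasDerivAt_sub_comp_add hx₃ hx₃₄ (hy₁.trans_lt ht.1))
  obtain ⟨t, ht, et⟩ := exists_ratio_hasDerivAt_eq_ratio_slope _ _ hy₃₄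
    (continuousOn_sub_comp_add hc hx₁ hx₁₂ hy₃)
    (fun t ht => h.hasDerivAt_sub_comp_add hx₁ hx₁₂ (hy₃.trans_lt ht.1)) _ _
    (continuousOn_sub_comp_add hc hx₃ hx₃₄ hy₃)
    (fun t ht => h.hasDerivAt_sub_comp_add hx₃ hx₃₄ (hy₃.trans_lt ht.1))
  have hs0 : 0 < s := hy₁.trans_lt hs.1
  have ht0 : 0 < t := hy₃.trans_lt ht.1
  have hst : s ≤ t := by linarith [hs.2, ht.1]
  -- The same theorem in x compares the increments at heights s and t through f 2 at a single
  -- abscissa, where log-convexity of f 2 applies.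
  have hcauchy : ∀ {x x' : ℝ}, 0 ≤ x → x < x' → ∃ z ∈ Ioo x x',
      (f 1 (x + s) - f 1 (x' + s)) * f 2 (z + t) = (f 1 (x + t) - f 1 (x' + t)) * f 2 (z + s) := by
    intro x x' hx hxx
    have hcont : ∀ {r : ℝ}, 0 < r → ContinuousOn (fun z => f 1 (z + r)) (Icc x x') :=
      fun {r} hr z hz => ((h.hasDerivAt 1 (z + r) (by linarith [hz.1])).comp_add_const
        z r).continuousAt.continuousWithinAt
    obtain ⟨z, hz, e⟩ := exists_ratio_hasDerivAt_eq_ratio_slope (fun z => f 1 (z + s)) _ hxx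
      (hcont hs0) (fun z hz => (h.hasDerivAt 1 (z + s) (by linarith [hz.1])).comp_add_const z s)
      (fun z => f 1 (z + t)) _ (hcont ht0)
      (fun z hz => (h.hasDerivAt 1 (z + t) (by linarith [hz.1])).comp_add_const z t)
    refine ⟨z, hz, ?_⟩
    norm_num at e
    linarith
  obtain ⟨z, hz, ez⟩ := hcauchy hx₁ hx₁₂
  obtain ⟨w, hw, ew⟩ := hcauchy hx₃ hx₃₄
  have hdec : ∀ {x x' r : ℝ}, 0 ≤ x → x < x' → 0 < r → 0 < f 1 (x + r) - f 1 (x' + r) := by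
    intro x x' r hx hxx hr
    obtain ⟨v, hv, ev⟩ := h.exists_sub_eq 1 (x := x + r) (y := x' + r) (by linarith) (by linarith)
    rw [ev]
    exact mul_pos (hpos _ _ (by linarith [hv.1])) (by linarith)
  have hf2 := h.mul_le_mul_of_add_eq hpos 2 (a := z + s) (b := w + s) (c := z + t) (d := w + t)
    (by linarith [hz.1]) (by linarith [hz.2, hw.1]) (by linarith) (by ring)
  have hD : (f 1 (x₁ + t) - f 1 (x₂ + t)) * (f 1 (x₃ + s) - f 1 (x₄ + s)) ≤
      (f 1 (x₁ + s) - f 1 (x₂ + s)) * (f 1 (x₃ + t) - f 1 (x₄ + t)) :=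
    mul_le_mul_of_mul_eq_mul (hdec hx₁ hx₁₂ hs0).le (hdec hx₃ hx₃₄ ht0).le
      (hpos 2 _ (by linarith [hz.1])) (hpos 2 _ (by linarith [hw.1])) ez ew hf2
  refine mul_le_mul_of_mul_eq_mul (h.mixedDifference_pos hpos hc hx₁ hx₁₂ hy₁ hy₁₂).le
    (h.mixedDifference_pos hpos hc hx₃ hx₃₄ hy₃ hy₃₄).le
    (hdec hx₁ hx₁₂ hs0) (hdec hx₃ hx₃₄ ht0) (p' := f 1 (x₃ + s) - f 1 (x₄ + s))
    (q := f 1 (x₁ + t) - f 1 (x₂ + t)) ?_ ?_ hD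
  · simp only [mixedDifference]; linarith
  · simp only [mixedDifference]; linarith

end IsAlternatingSequence

/-! ### Archimedean generators and Laplace transforms -/

theorem generatorInv_spec {F : ℝ → ℝ} (hc : ContinuousOn F (Ici 0)) (h0 : F 0 = 1)
    (hlim : Tendsto F atTop (𝓝 0)) {u : ℝ} (hu : u ∈ Ioc (0 : ℝ) 1) :
    0 ≤ generatorInv F u ∧ F (generatorInv F u) = u := by
  obtain ⟨x, hxu, hx0⟩ := ((hlim.eventually (gt_mem_nhds hu.1)).and
    (eventually_ge_atTop (0 : ℝ))).exists
  have hmem : u ∈ F '' Ici 0 := by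
    have h1 := intermediate_value_Icc' hx0 (hc.mono fun t ht => ht.1)
    obtain ⟨s, hs, he⟩ := h1 (show u ∈ Icc (F x) (F 0) from ⟨hxu.le, h0 ▸ hu.2⟩)
    exact ⟨s, hs.1, he⟩
  exact ⟨Function.invFunOn_mem hmem, Function.invFunOn_eq hmem⟩

namespace IsArchimedeanGenerator

variable {φ : ℝ → ℝ}

/-- Strict convexity makes φ strictly increasing after any failure of strict decrease, so a
nonnegative φ could not tend to 0. -/
theorem strictAntiOn (h : IsArchimedeanGenerator φ) : StrictAntiOn φ (Ici 0) := by
  intro s hs t ht hst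
  by_contra! hle
  have hs0 : 0 ≤ s := hs
  have step : ∀ {a b c : ℝ}, 0 ≤ a → a < b → b < c → φ a ≤ φ b → φ b < φ c := by
    intro a b c ha hab hbc hab'
    have h1 := h.strictConvexOn.lt_on_openSegment (x := a) (y := c) ha
      (show (0 : ℝ) ≤ c by linarith) (by linarith)
      (z := b) (by rw [openSegment_eq_Ioo (by linarith)]; exact ⟨hab, hbc⟩)
    rcases lt_max_iff.1 h1 with h2 | h2
    · exact absurd h2 hab'.not_gt
    · exact h2
  have h1 : φ t < φ (t + 1) := step hs0 hst (by linarith) hle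
  have h2 : φ (t + 1) ≤ 0 := by
    refine ge_of_tendsto h.tendsto_zero ?_
    filter_upwards [eventually_gt_atTop (t + 1)] with r hr
    exact (step (by linarith) (by linarith) hr h1.le).le
  have h3 := h.nonneg t ht
  linarith

theorem pos (h : IsArchimedeanGenerator φ) {s : ℝ} (hs : 0 ≤ s) : 0 < φ s :=
  (h.nonneg (s + 1) (by linarith)).trans_lt
    (h.strictAntiOn hs (show (0 : ℝ) ≤ s + 1 by linarith) (by linarith))

theorem le_one (h : IsArchimedeanGenerator φ) {s : ℝ} (hs : 0 ≤ s) : φ s ≤ 1 :=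
  h.map_zero ▸ h.strictAntiOn.antitoneOn (mem_Ici.2 le_rfl) hs hs

end IsArchimedeanGenerator

namespace IsLaplaceTransform

variable {ψ : ℝ → ℝ}

theorem map_zero (h : IsLaplaceTransform ψ) : ψ 0 = 1 := by
  obtain ⟨M, hM, -, hψ⟩ := h
  simp [hψ 0 le_rfl]

theorem ae_norm_exp_le {M : Measure ℝ} (h0 : M (Iic 0) = 0) {s : ℝ} (hs : 0 ≤ s) :
    ∀ᵐ a ∂M, ‖Real.exp (-(s * a))‖ ≤ 1 := by
  have hpos : ∀ᵐ a ∂M, a ∉ Iic (0 : ℝ) := measure_eq_zero_iff_ae_notMem.1 h0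
  filter_upwards [hpos] with a ha
  rw [Real.norm_of_nonneg (Real.exp_nonneg _), Real.exp_le_one_iff]
  have := mul_nonneg hs (not_le.1 ha).le
  linarith

theorem pos (h : IsLaplaceTransform ψ) {s : ℝ} (hs : 0 ≤ s) : 0 < ψ s := by
  obtain ⟨M, hM, h0, hψ⟩ := h
  rw [hψ s hs]
  exact integral_exp_pos (Integrable.of_bound (by fun_prop) 1 (ae_norm_exp_le h0 hs))

theorem continuousOn (h : IsLaplaceTransform ψ) : ContinuousOn ψ (Ici 0) := by
  obtain ⟨M, hM, h0, hψ⟩ := h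
  refine ContinuousOn.congr ?_ hψ
  refine continuousOn_of_dominated (bound := fun _ => 1) (fun s _ => by fun_prop)
    (fun s hs => ae_norm_exp_le h0 hs) (integrable_const _) (ae_of_all _ fun a => by fun_prop)

theorem tendsto_zero (h : IsLaplaceTransform ψ) : Tendsto ψ atTop (𝓝 0) := by
  obtain ⟨M, hM, h0, hψ⟩ := h
  have hpos : ∀ᵐ a ∂M, a ∉ Iic (0 : ℝ) := measure_eq_zero_iff_ae_notMem.1 h0
  have h1 : Tendsto (fun s : ℝ => ∫ a, Real.exp (-(s * a)) ∂M) atTop (𝓝 (∫ _, (0 : ℝ) ∂M)) := by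
    refine tendsto_integral_filter_of_dominated_convergence (fun _ => 1)
      (Eventually.of_forall fun s => by fun_prop) ?_ (integrable_const _) ?_
    · filter_upwards [eventually_ge_atTop (0 : ℝ)] with s hs using ae_norm_exp_le h0 hs
    · filter_upwards [hpos] with a ha
      exact Real.tendsto_exp_neg_atTop_nhds_zero.comp
        (tendsto_id.atTop_mul_const (not_le.1 ha))
  rw [integral_zero] at h1
  refine h1.congr' ?_
  filter_upwards [eventually_ge_atTop (0 : ℝ)] with s hs using (hψ s hs).symm

end IsLaplaceTransform

/-! ### The two-parameter copula as an Archimedean copula -/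

/-- `C` is, on the half-open unit square, the Archimedean copula with generator `f 0` and inverse
generator `g`, where `f` is the positive alternating sequence of derivatives of the generator. -/
structure IsAlternatingGenerator (f : ℕ → ℝ → ℝ) (g : ℝ → ℝ) (C : ℝ → ℝ → ℝ) : Prop where
  alternating : IsAlternatingSequence f
  pos : ∀ k x, 0 < x → 0 < f k x
  continuousOn : ContinuousOn (f 0) (Ici 0)
  inv_nonneg : ∀ u ∈ Ioc (0 : ℝ) 1, 0 ≤ g u
  apply_inv : ∀ u ∈ Ioc (0 : ℝ) 1, f 0 (g u) = u
  copula_eq : ∀ u ∈ Ioc (0 : ℝ) 1, ∀ v ∈ Ioc (0 : ℝ) 1, C u v = f 0 (g u + g v)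

theorem IsCompletelyMonotone.isAlternatingSequence {η : ℝ → ℝ} (h : IsCompletelyMonotone η) :
    IsAlternatingSequence fun k x => (-1) ^ k * iteratedDerivWithin k η (Ioi 0) x where
  nonneg := h.alternating
  hasDerivAt k x hx := by
    have h1 : DifferentiableAt ℝ (iteratedDerivWithin k η (Ioi 0)) x :=
      (h.contDiffOn.differentiableOn_iteratedDerivWithin (by exact_mod_cast ENat.natCast_lt_top k)
        (uniqueDiffOn_Ioi 0)).differentiableAt (Ioi_mem_nhds hx)
    have h2 := h1.hasDerivAt
    rw [← derivWithin_of_mem_nhds (Ioi_mem_nhds hx), ← iteratedDerivWithin_succ] at h2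
    have h3 := h2.const_mul ((-1 : ℝ) ^ k)
    rwa [show -((-1 : ℝ) ^ (k + 1) * iteratedDerivWithin (k + 1) η (Ioi 0) x) =
      (-1 : ℝ) ^ k * iteratedDerivWithin (k + 1) η (Ioi 0) x by ring]

/-- With g u = φ⁻¹(exp(-ψ⁻¹ u)) the formula of the copula is literally η(g u + g v). All derivatives
are nonzero because η is positive and tends to 0. -/
theorem exists_isAlternatingGenerator {ψ φ : ℝ → ℝ} (hψ : IsLaplaceTransform ψ)
    (hφ : IsArchimedeanGenerator φ) (hη : IsCompletelyMonotone (twoParameterGenerator ψ φ)) :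
    ∃ f g, IsAlternatingGenerator f g (twoParameterCopula ψ φ) := by
  have hψi := fun u (hu : u ∈ Ioc (0 : ℝ) 1) =>
    generatorInv_spec hψ.continuousOn hψ.map_zero hψ.tendsto_zero hu
  have hφi := fun u (hu : u ∈ Ioc (0 : ℝ) 1) =>
    generatorInv_spec hφ.continuousOn hφ.map_zero hφ.tendsto_zero hu
  have hexp : ∀ u ∈ Ioc (0 : ℝ) 1, Real.exp (-generatorInv ψ u) ∈ Ioc (0 : ℝ) 1 := fun u hu =>
    ⟨Real.exp_pos _, Real.exp_le_one_iff.2 (neg_nonpos.2 (hψi u hu).1)⟩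
  have hlog : ∀ s, 0 ≤ s → 0 ≤ -Real.log (φ s) := fun s hs =>
    neg_nonneg.2 (Real.log_nonpos (hφ.nonneg s hs) (hφ.le_one hs))
  have hlim : Tendsto (twoParameterGenerator ψ φ) atTop (𝓝 0) := by
    refine hψ.tendsto_zero.comp (tendsto_neg_atBot_atTop.comp (Real.tendsto_log_nhdsGT_zero.comp ?_))
    refine tendsto_nhdsWithin_iff.2 ⟨hφ.tendsto_zero, ?_⟩
    filter_upwards [eventually_ge_atTop (0 : ℝ)] with s hs using hφ.pos hs
  have hzero : (fun x => (-1 : ℝ) ^ 0 *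
      iteratedDerivWithin 0 (twoParameterGenerator ψ φ) (Ioi 0) x) =
      twoParameterGenerator ψ φ := by
    simp [iteratedDerivWithin_zero]
  refine ⟨_, fun u => generatorInv φ (Real.exp (-generatorInv ψ u)),
    hη.isAlternatingSequence, ?_, ?_, fun u hu => (hφi _ (hexp u hu)).1, fun u hu => ?_,
    fun u hu v hv => ?_⟩
  · refine hη.isAlternatingSequence.pos (fun x hx => ?_) ?_
    · exact (congrFun hzero x).symm ▸ hψ.pos (hlog x hx.le)
    · exact hzero.symm ▸ hlim
  · exact hzero.symm ▸ hη.continuousOn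
  · rw [congrFun hzero, twoParameterGenerator, (hφi _ (hexp u hu)).2, Real.log_exp, neg_neg,
      (hψi u hu).2]
  · rw [congrFun hzero, twoParameterGenerator, twoParameterCopula, if_pos ⟨hu.1, hv.1⟩,
      archimedeanCopula, if_pos ⟨Real.exp_pos _, Real.exp_pos _⟩]

namespace IsAlternatingGenerator

variable {f : ℕ → ℝ → ℝ} {g : ℝ → ℝ} {C : ℝ → ℝ → ℝ}

theorem antitoneOn (h : IsAlternatingGenerator f g C) : AntitoneOn (f 0) (Ici 0) := by
  have h1 := h.alternating.antitoneOn 0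
  refine antitoneOn_of_hasDerivWithinAt_nonpos (f' := fun x => -f 1 x) (convex_Ici 0)
    h.continuousOn ?_ ?_ <;> rw [interior_Ici]
  · exact fun x hx => (h.alternating.hasDerivAt 0 x hx).hasDerivWithinAt
  · exact fun x hx => neg_nonpos.2 (h.alternating.nonneg 1 x hx)

theorem inv_lt_inv (h : IsAlternatingGenerator f g C) {u v : ℝ} (hu : u ∈ Ioc (0 : ℝ) 1)
    (hv : v ∈ Ioc (0 : ℝ) 1) (huv : u < v) : g v < g u := by
  by_contra! hle
  have h1 := h.antitoneOn (h.inv_nonneg u hu) (h.inv_nonneg v hv) hle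
  rw [h.apply_inv u hu, h.apply_inv v hv] at h1
  linarith

theorem inv_le_inv (h : IsAlternatingGenerator f g C) {u v : ℝ} (hu : u ∈ Ioc (0 : ℝ) 1)
    (hv : v ∈ Ioc (0 : ℝ) 1) (huv : u ≤ v) : g v ≤ g u := by
  rcases huv.eq_or_lt with rfl | huv
  · exact le_rfl
  · exact (h.inv_lt_inv hu hv huv).le

end IsAlternatingGenerator

/-! ### Masses of rectangles -/

namespace IsCopulaLaw

variable {C : ℝ → ℝ → ℝ} {P : Measure (ℝ × ℝ)} {f : ℕ → ℝ → ℝ} {g : ℝ → ℝ}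

theorem measure_preimage_fst (h : IsCopulaLaw C P) {A : Set ℝ} (hA : MeasurableSet A) :
    P (Prod.fst ⁻¹' A) = volume (A ∩ Icc 0 1) := by
  rw [← Measure.map_apply measurable_fst hA, h.map_fst, Measure.restrict_apply hA]

theorem measure_preimage_snd (h : IsCopulaLaw C P) {A : Set ℝ} (hA : MeasurableSet A) :
    P (Prod.snd ⁻¹' A) = volume (A ∩ Icc 0 1) := by
  rw [← Measure.map_apply measurable_snd hA, h.map_snd, Measure.restrict_apply hA]

theorem isProbabilityMeasure (h : IsCopulaLaw C P) : IsProbabilityMeasure P := by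
  constructor
  rw [← preimage_univ (f := Prod.fst), h.measure_preimage_fst MeasurableSet.univ]
  simp

theorem measure_preimage_fst_Iic_le (h : IsCopulaLaw C P) (a : ℝ) :
    P (Prod.fst ⁻¹' Iic a) ≤ ENNReal.ofReal a := by
  rw [h.measure_preimage_fst measurableSet_Iic]
  calc volume (Iic a ∩ Icc 0 1) ≤ volume (Icc 0 a) := measure_mono fun x hx => ⟨hx.2.1, hx.1⟩
    _ = ENNReal.ofReal a := by simp

theorem measure_preimage_snd_Iic_le (h : IsCopulaLaw C P) (a : ℝ) :
    P (Prod.snd ⁻¹' Iic a) ≤ ENNReal.ofReal a := by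
  rw [h.measure_preimage_snd measurableSet_Iic]
  calc volume (Iic a ∩ Icc 0 1) ≤ volume (Icc 0 a) := measure_mono fun x hx => ⟨hx.2.1, hx.1⟩
    _ = ENNReal.ofReal a := by simp

theorem measureReal_Ioc_prod_Ioc [IsFiniteMeasure P] {u u' v v' : ℝ} (hu : u ≤ u')
    (hv : v ≤ v') : P.real (Ioc u u' ×ˢ Ioc v v') =
      P.real (Iic u' ×ˢ Iic v') - P.real (Iic u ×ˢ Iic v') - P.real (Iic u' ×ˢ Iic v) +
        P.real (Iic u ×ˢ Iic v) := by
  have strip : ∀ w, P.real (Ioc u u' ×ˢ Iic w) =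
      P.real (Iic u' ×ˢ Iic w) - P.real (Iic u ×ˢ Iic w) := by
    intro w
    rw [← measureReal_sdiff (prod_mono_left (Iic_subset_Iic.2 hu))
      (measurableSet_Iic.prod measurableSet_Iic)]
    congr 1
    ext x
    simp only [mem_prod, mem_Ioc, mem_Iic, Set.mem_sdiff, not_and, not_le]
    exact ⟨fun hx => ⟨⟨hx.1.2, hx.2⟩, fun hx' => absurd hx' hx.1.1.not_ge⟩,
      fun hx => ⟨⟨lt_of_not_ge fun hx' => (hx.2 hx').not_ge hx.1.2, hx.1.1⟩, hx.1.2⟩⟩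
  have : P.real (Ioc u u' ×ˢ Ioc v v') =
      P.real (Ioc u u' ×ˢ Iic v') - P.real (Ioc u u' ×ˢ Iic v) := by
    rw [← measureReal_sdiff (prod_mono_right (Iic_subset_Iic.2 hv))
      (measurableSet_Ioc.prod measurableSet_Iic)]
    congr 1
    ext x
    simp only [mem_prod, mem_Ioc, mem_Iic, Set.mem_sdiff, not_and, not_le]
    exact ⟨fun hx => ⟨⟨hx.1, hx.2.2⟩, fun _ => hx.2.1⟩,
      fun hx => ⟨hx.1.1, hx.2 hx.1.1, hx.1.2⟩⟩
  rw [this, strip, strip]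
  ring

theorem measureReal_rectangle (h : IsCopulaLaw C P) (hg : IsAlternatingGenerator f g C)
    {u u' v v' : ℝ} (hu : 0 < u) (huu : u ≤ u') (hu' : u' ≤ 1) (hv : 0 < v) (hvv : v ≤ v')
    (hv' : v' ≤ 1) :
    P.real (Ioc u u' ×ˢ Ioc v v') = mixedDifference (f 0) (g u') (g u) (g v') (g v) := by
  have := h.isProbabilityMeasure
  have mu : u ∈ Ioc (0 : ℝ) 1 := ⟨hu, huu.trans hu'⟩
  have mu' : u' ∈ Ioc (0 : ℝ) 1 := ⟨hu.trans_le huu, hu'⟩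
  have mv : v ∈ Ioc (0 : ℝ) 1 := ⟨hv, hvv.trans hv'⟩
  have mv' : v' ∈ Ioc (0 : ℝ) 1 := ⟨hv.trans_le hvv, hv'⟩
  have key : ∀ a ∈ Ioc (0 : ℝ) 1, ∀ b ∈ Ioc (0 : ℝ) 1,
      P.real (Iic a ×ˢ Iic b) = f 0 (g a + g b) := fun a ha b hb => by
    rw [h.cdf_eq a (Ioc_subset_Icc_self ha) b (Ioc_subset_Icc_self hb), hg.copula_eq a ha b hb]
  rw [measureReal_Ioc_prod_Ioc huu hvv, key _ mu' _ mv', key _ mu _ mv', key _ mu' _ mv,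
    key _ mu _ mv, mixedDifference]

theorem measureReal_rectangle_pos (h : IsCopulaLaw C P) (hg : IsAlternatingGenerator f g C)
    {u u' v v' : ℝ} (hu : 0 ≤ u) (huu : u < u') (hu' : u' ≤ 1) (hv : 0 ≤ v) (hvv : v < v')
    (hv' : v' ≤ 1) : 0 < P.real (Ioc u u' ×ˢ Ioc v v') := by
  have := h.isProbabilityMeasure
  -- The generator formula needs corners off the axes, so the rectangle is first replaced by its
  -- upper right quarter.
  have h1 : 0 < P.real (Ioc ((u + u') / 2) u' ×ˢ Ioc ((v + v') / 2) v') := by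
    rw [h.measureReal_rectangle hg (by linarith) (by linarith) hu' (by linarith) (by linarith) hv']
    have mu : (u + u') / 2 ∈ Ioc (0 : ℝ) 1 := ⟨by linarith, by linarith⟩
    have mv : (v + v') / 2 ∈ Ioc (0 : ℝ) 1 := ⟨by linarith, by linarith⟩
    have mu' : u' ∈ Ioc (0 : ℝ) 1 := ⟨by linarith, hu'⟩
    have mv' : v' ∈ Ioc (0 : ℝ) 1 := ⟨by linarith, hv'⟩
    exact hg.alternating.mixedDifference_pos hg.pos hg.continuousOn (hg.inv_nonneg _ mu')
      (hg.inv_lt_inv mu mu' (by linarith)) (hg.inv_nonneg _ mv')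
      (hg.inv_lt_inv mv mv' (by linarith))
  exact h1.trans_le (measureReal_mono (prod_mono (Ioc_subset_Ioc_left (by linarith))
    (Ioc_subset_Ioc_left (by linarith))))

/-- Reaches rectangles touching the axes: with uniform marginals, cutting off the strips of width ε
loses mass at most 2ε. -/
theorem tendsto_measureReal_rectangle (h : IsCopulaLaw C P) (u u' v v' : ℝ) :
    Tendsto (fun ε => P.real (Ioc (max u ε) u' ×ˢ Ioc (max v ε) v')) (𝓝[>] 0)
      (𝓝 (P.real (Ioc u u' ×ˢ Ioc v v'))) := by
  have := h.isProbabilityMeasure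
  have hlow : Tendsto (fun ε : ℝ => P.real (Ioc u u' ×ˢ Ioc v v') - 2 * ε) (𝓝[>] 0)
      (𝓝 (P.real (Ioc u u' ×ˢ Ioc v v'))) := by
    have : Tendsto (fun ε : ℝ => P.real (Ioc u u' ×ˢ Ioc v v') - 2 * ε) (𝓝 0)
        (𝓝 (P.real (Ioc u u' ×ˢ Ioc v v') - 2 * 0)) := by
      apply Continuous.tendsto; fun_prop
    simpa using this.mono_left nhdsWithin_le_nhds
  refine tendsto_of_tendsto_of_tendsto_of_le_of_le' hlow tendsto_const_nhds ?_ ?_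
  · filter_upwards [self_mem_nhdsWithin] with ε (hε : 0 < ε)
    have hsub : Ioc u u' ×ˢ Ioc v v' ⊆ Ioc (max u ε) u' ×ˢ Ioc (max v ε) v' ∪
        (Prod.fst ⁻¹' Iic ε ∪ Prod.snd ⁻¹' Iic ε) := by
      rintro ⟨a, b⟩ ⟨ha, hb⟩
      by_cases h1 : a ≤ ε
      · exact Or.inr (Or.inl h1)
      by_cases h2 : b ≤ ε
      · exact Or.inr (Or.inr h2)
      · exact Or.inl ⟨⟨max_lt ha.1 (not_le.1 h1), ha.2⟩, ⟨max_lt hb.1 (not_le.1 h2), hb.2⟩⟩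
    have h1 : P.real (Prod.fst ⁻¹' Iic ε) ≤ ε :=
      ENNReal.toReal_le_of_le_ofReal hε.le (h.measure_preimage_fst_Iic_le ε)
    have h2 : P.real (Prod.snd ⁻¹' Iic ε) ≤ ε :=
      ENNReal.toReal_le_of_le_ofReal hε.le (h.measure_preimage_snd_Iic_le ε)
    have h3 := (measureReal_mono (μ := P) hsub).trans (measureReal_union_le _ _)
    have h4 := measureReal_union_le (μ := P) (Prod.fst ⁻¹' Iic ε) (Prod.snd ⁻¹' Iic ε)
    linarith
  · exact Eventually.of_forall fun ε => measureReal_mono (prod_mono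
      (Ioc_subset_Ioc_left (le_max_left _ _)) (Ioc_subset_Ioc_left (le_max_left _ _)))

theorem measureReal_rectangle_mul_le_of_pos (h : IsCopulaLaw C P)
    (hg : IsAlternatingGenerator f g C) {u₁ u₂ u₃ u₄ v₁ v₂ v₃ v₄ : ℝ} (hu₁ : 0 < u₁)
    (hu₁₂ : u₁ < u₂) (hu₂₃ : u₂ ≤ u₃) (hu₃₄ : u₃ < u₄) (hu₄ : u₄ ≤ 1) (hv₁ : 0 < v₁)
    (hv₁₂ : v₁ < v₂) (hv₂₃ : v₂ ≤ v₃) (hv₃₄ : v₃ < v₄) (hv₄ : v₄ ≤ 1) :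
    P.real (Ioc u₁ u₂ ×ˢ Ioc v₃ v₄) * P.real (Ioc u₃ u₄ ×ˢ Ioc v₁ v₂) ≤
      P.real (Ioc u₁ u₂ ×ˢ Ioc v₁ v₂) * P.real (Ioc u₃ u₄ ×ˢ Ioc v₃ v₄) := by
  have mu₁ : u₁ ∈ Ioc (0 : ℝ) 1 := ⟨by linarith, by linarith⟩
  have mu₂ : u₂ ∈ Ioc (0 : ℝ) 1 := ⟨by linarith, by linarith⟩
  have mu₃ : u₃ ∈ Ioc (0 : ℝ) 1 := ⟨by linarith, by linarith⟩
  have mu₄ : u₄ ∈ Ioc (0 : ℝ) 1 := ⟨by linarith, by linarith⟩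
  have mv₁ : v₁ ∈ Ioc (0 : ℝ) 1 := ⟨by linarith, by linarith⟩
  have mv₂ : v₂ ∈ Ioc (0 : ℝ) 1 := ⟨by linarith, by linarith⟩
  have mv₃ : v₃ ∈ Ioc (0 : ℝ) 1 := ⟨by linarith, by linarith⟩
  have mv₄ : v₄ ∈ Ioc (0 : ℝ) 1 := ⟨by linarith, by linarith⟩
  rw [h.measureReal_rectangle hg mu₁.1 hu₁₂.le mu₂.2 mv₃.1 hv₃₄.le mv₄.2,
    h.measureReal_rectangle hg mu₃.1 hu₃₄.le mu₄.2 mv₁.1 hv₁₂.le mv₂.2,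
    h.measureReal_rectangle hg mu₁.1 hu₁₂.le mu₂.2 mv₁.1 hv₁₂.le mv₂.2,
    h.measureReal_rectangle hg mu₃.1 hu₃₄.le mu₄.2 mv₃.1 hv₃₄.le mv₄.2]
  -- The inverse generator reverses both axes, so the indices run backwards and the two factors on
  -- the right are exchanged.
  refine (hg.alternating.mixedDifference_mul_le hg.pos hg.continuousOn (hg.inv_nonneg _ mu₄)
    (hg.inv_lt_inv mu₃ mu₄ hu₃₄) (hg.inv_le_inv mu₂ mu₃ hu₂₃) (hg.inv_lt_inv mu₁ mu₂ hu₁₂)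
    (hg.inv_nonneg _ mv₄) (hg.inv_lt_inv mv₃ mv₄ hv₃₄) (hg.inv_le_inv mv₂ mv₃ hv₂₃)
    (hg.inv_lt_inv mv₁ mv₂ hv₁₂)).trans_eq (mul_comm _ _)

/-- Total positivity of order two of the masses of rectangles. -/
theorem measureReal_rectangle_mul_le (h : IsCopulaLaw C P)
    (hg : IsAlternatingGenerator f g C) {u₁ u₂ u₃ u₄ v₁ v₂ v₃ v₄ : ℝ} (hu₁ : 0 ≤ u₁)
    (hu₁₂ : u₁ < u₂) (hu₂₃ : u₂ ≤ u₃) (hu₃₄ : u₃ < u₄) (hu₄ : u₄ ≤ 1) (hv₁ : 0 ≤ v₁)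
    (hv₁₂ : v₁ < v₂) (hv₂₃ : v₂ ≤ v₃) (hv₃₄ : v₃ < v₄) (hv₄ : v₄ ≤ 1) :
    P.real (Ioc u₁ u₂ ×ˢ Ioc v₃ v₄) * P.real (Ioc u₃ u₄ ×ˢ Ioc v₁ v₂) ≤
      P.real (Ioc u₁ u₂ ×ˢ Ioc v₁ v₂) * P.real (Ioc u₃ u₄ ×ˢ Ioc v₃ v₄) := by
  refine le_of_tendsto_of_tendsto
    ((h.tendsto_measureReal_rectangle u₁ u₂ v₃ v₄).mul (h.tendsto_measureReal_rectangle u₃ u₄ v₁ v₂))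
    ((h.tendsto_measureReal_rectangle u₁ u₂ v₁ v₂).mul (h.tendsto_measureReal_rectangle u₃ u₄ v₃ v₄))
    ?_
  filter_upwards [Ioo_mem_nhdsGT (show (0 : ℝ) < min u₂ v₂ from
    lt_min (hu₁.trans_lt hu₁₂) (hv₁.trans_lt hv₁₂))] with ε hε
  have hεu : ε < u₂ := hε.2.trans_le (min_le_left _ _)
  have hεv : ε < v₂ := hε.2.trans_le (min_le_right _ _)
  exact h.measureReal_rectangle_mul_le_of_pos hg (hε.1.trans_le (le_max_right _ _))
    (max_lt hu₁₂ hεu) (hu₂₃.trans (le_max_left _ _)) (max_lt hu₃₄ (by linarith)) hu₄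
    (hε.1.trans_le (le_max_right _ _)) (max_lt hv₁₂ hεv) (hv₂₃.trans (le_max_left _ _))
    (max_lt hv₃₄ (by linarith)) hv₄

/-! ### Absolute continuity -/

theorem _root_.IsAlternatingGenerator.inv_sub_inv_le (hg : IsAlternatingGenerator f g C)
    {w a b : ℝ} (hw : 0 < w) (hwa : w ≤ a) (hab : a < b) (hb : b < 1) :
    g a - g b ≤ (b - a) / f 1 (g w) := by
  have ma : a ∈ Ioc (0 : ℝ) 1 := ⟨by linarith, by linarith⟩
  have mb : b ∈ Ioc (0 : ℝ) 1 := ⟨by linarith, by linarith⟩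
  have mw : w ∈ Ioc (0 : ℝ) 1 := ⟨hw, by linarith⟩
  have m1 : (1 : ℝ) ∈ Ioc (0 : ℝ) 1 := ⟨one_pos, le_rfl⟩
  have hgb : 0 < g b := (hg.inv_nonneg 1 m1).trans_lt (hg.inv_lt_inv mb m1 hb)
  obtain ⟨z, hz, he⟩ := hg.alternating.exists_sub_eq 0 hgb (hg.inv_lt_inv ma mb hab)
  rw [hg.apply_inv a ma, hg.apply_inv b mb] at he
  have hgw : 0 < g w := hgb.trans (hg.inv_lt_inv mw mb (by linarith))
  have h1 : f 1 (g w) ≤ f 1 z := hg.alternating.antitoneOn 1 (hgb.trans hz.1) hgw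
    (hz.2.le.trans (hg.inv_le_inv mw ma hwa))
  have hd := hg.inv_lt_inv ma mb hab
  rw [le_div_iff₀ (hg.pos 1 _ hgw), he]
  nlinarith

/-- Local boundedness of the density: a rectangle's mass is f 2 at an intermediate point times the
increments of g, which are Lipschitz away from the axes and from 1. -/
theorem exists_eventually_measure_closedBall_le (h : IsCopulaLaw C P)
    (hg : IsAlternatingGenerator f g C) {u v : ℝ} (hu : u ∈ Ioo (0 : ℝ) 1)
    (hv : v ∈ Ioo (0 : ℝ) 1) :
    ∃ K : ℕ, ∀ᶠ r in 𝓝[>] (0 : ℝ), P (Metric.closedBall (u, v) r) ≤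
      ((K : NNReal) • (volume : Measure (ℝ × ℝ))) (Metric.closedBall (u, v) r) := by
  have := h.isProbabilityMeasure
  obtain ⟨hu0, hu1⟩ := hu
  obtain ⟨hv0, hv1⟩ := hv
  have m1 : (1 : ℝ) ∈ Ioc (0 : ℝ) 1 := ⟨one_pos, le_rfl⟩
  have mu2 : (1 + u) / 2 ∈ Ioc (0 : ℝ) 1 := ⟨by linarith, by linarith⟩
  have hpos : ∀ {w : ℝ}, 0 < w → w < 1 → 0 < g w := fun hw hw1 =>
    (hg.inv_nonneg 1 m1).trans_lt (hg.inv_lt_inv ⟨hw, hw1.le⟩ m1 hw1)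
  have hY : 0 < g ((1 + u) / 2) := hpos (by linarith) (by linarith)
  have ha : 0 < f 1 (g (u / 2)) := hg.pos 1 _ (hpos (by linarith) (by linarith))
  have hb : 0 < f 1 (g (v / 2)) := hg.pos 1 _ (hpos (by linarith) (by linarith))
  have hc : 0 < f 2 (g ((1 + u) / 2)) := hg.pos 2 _ hY
  -- The factor 4 arises from enclosing the ball of side 2r in a half-open square of side 4r.
  obtain ⟨K, hK⟩ := exists_nat_ge
    (f 2 (g ((1 + u) / 2)) * 4 / (f 1 (g (u / 2)) * f 1 (g (v / 2))))
  refine ⟨K, ?_⟩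
  have hr0 : 0 < min (min (u / 4) ((1 - u) / 4)) (min (v / 4) ((1 - v) / 4)) := by
    refine lt_min (lt_min ?_ ?_) (lt_min ?_ ?_) <;> linarith
  filter_upwards [Ioo_mem_nhdsGT hr0] with r hr
  obtain ⟨hr, hr'⟩ := hr
  simp only [lt_min_iff] at hr'
  obtain ⟨⟨h1, h2⟩, h3, h4⟩ := hr'
  have hball : Metric.closedBall (u, v) r ⊆
      Ioc (u - 2 * r) (u + 2 * r) ×ˢ Ioc (v - 2 * r) (v + 2 * r) := by
    rw [← closedBall_prod_same, Real.closedBall_eq_Icc, Real.closedBall_eq_Icc]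
    refine prod_mono ?_ ?_ <;> exact fun x hx => ⟨by linarith [hx.1], by linarith [hx.2]⟩
  have hvol : volume (Metric.closedBall (u, v) r) = ENNReal.ofReal ((2 * r) * (2 * r)) := by
    rw [← closedBall_prod_same, Measure.volume_eq_prod, Measure.prod_prod, Real.volume_closedBall,
      Real.volume_closedBall, ← ENNReal.ofReal_mul (by linarith)]
  have mem : ∀ {x : ℝ}, 0 < x → x < 1 → x ∈ Ioc (0 : ℝ) 1 := fun h h' => ⟨h, h'.le⟩
  have mua := mem (x := u - 2 * r) (by linarith) (by linarith)
  have mub := mem (x := u + 2 * r) (by linarith) (by linarith)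
  have mva := mem (x := v - 2 * r) (by linarith) (by linarith)
  have mvb := mem (x := v + 2 * r) (by linarith) (by linarith)
  have hgu := hg.inv_lt_inv mua mub (by linarith)
  have hgv := hg.inv_lt_inv mva mvb (by linarith)
  obtain ⟨z, hz, t, ht, he⟩ := hg.alternating.exists_mixedDifference_eq hg.continuousOn
    (hg.inv_nonneg _ mub) hgu (hg.inv_nonneg _ mvb) hgv
  rw [← h.measureReal_rectangle hg mua.1 (by linarith) mub.2 mva.1 (by linarith) mvb.2] at he
  have hbound : P.real (Ioc (u - 2 * r) (u + 2 * r) ×ˢ Ioc (v - 2 * r) (v + 2 * r)) ≤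
      K * ((2 * r) * (2 * r)) := by
    have e1 : f 2 (z + t) ≤ f 2 (g ((1 + u) / 2)) := by
      have h5 : g ((1 + u) / 2) ≤ g (u + 2 * r) := hg.inv_le_inv mub mu2 (by linarith)
      have h6 := hg.inv_nonneg _ mvb
      exact hg.alternating.antitoneOn 2 hY (show 0 < z + t by linarith [hz.1, ht.1])
        (by linarith [hz.1, ht.1])
    have e2 := hg.inv_sub_inv_le (w := u / 2) (a := u - 2 * r) (b := u + 2 * r)
      (by linarith) (by linarith) (by linarith) (by linarith)
    have e3 := hg.inv_sub_inv_le (w := v / 2) (a := v - 2 * r) (b := v + 2 * r)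
      (by linarith) (by linarith) (by linarith) (by linarith)
    rw [he]
    calc f 2 (z + t) * (g (u - 2 * r) - g (u + 2 * r)) * (g (v - 2 * r) - g (v + 2 * r))
        ≤ f 2 (g ((1 + u) / 2)) * ((u + 2 * r - (u - 2 * r)) / f 1 (g (u / 2))) *
          ((v + 2 * r - (v - 2 * r)) / f 1 (g (v / 2))) := by
          have := sub_pos.2 hgu
          have := sub_pos.2 hgv
          have : 0 ≤ (u + 2 * r - (u - 2 * r)) / f 1 (g (u / 2)) :=
            div_nonneg (by linarith) ha.le
          gcongr
      _ = f 2 (g ((1 + u) / 2)) * 4 / (f 1 (g (u / 2)) * f 1 (g (v / 2))) *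
          ((2 * r) * (2 * r)) := by field_simp; ring
      _ ≤ _ := by gcongr
  calc P (Metric.closedBall (u, v) r)
      ≤ P (Ioc (u - 2 * r) (u + 2 * r) ×ˢ Ioc (v - 2 * r) (v + 2 * r)) := measure_mono hball
    _ = ENNReal.ofReal (P.real (Ioc (u - 2 * r) (u + 2 * r) ×ˢ Ioc (v - 2 * r) (v + 2 * r))) :=
        (ofReal_measureReal).symm
    _ ≤ ENNReal.ofReal (K * ((2 * r) * (2 * r))) := ENNReal.ofReal_le_ofReal hbound
    _ = _ := by
      rw [ENNReal.ofReal_mul (by positivity), Measure.smul_apply, hvol, ENNReal.smul_def,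
        ENNReal.ofReal_natCast]
      simp

theorem measure_compl_unitSquare (h : IsCopulaLaw C P) :
    P ((Ioo (0 : ℝ) 1 ×ˢ Ioo (0 : ℝ) 1)ᶜ) = 0 := by
  have hm : MeasurableSet (Ioo (0 : ℝ) 1)ᶜ := measurableSet_Ioo.compl
  have hz : volume ((Ioo (0 : ℝ) 1)ᶜ ∩ Icc 0 1) = 0 := by
    refine measure_mono_null (t := {0, 1}) ?_ (Set.Finite.measure_zero (by simp) _)
    rintro x ⟨hx, hx'⟩
    by_contra hne
    simp only [mem_insert_iff, mem_singleton_iff, not_or] at hne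
    exact hx ⟨lt_of_le_of_ne hx'.1 (Ne.symm hne.1), lt_of_le_of_ne hx'.2 hne.2⟩
  refine measure_mono_null (t := Prod.fst ⁻¹' (Ioo (0 : ℝ) 1)ᶜ ∪ Prod.snd ⁻¹' (Ioo (0 : ℝ) 1)ᶜ)
    ?_ (measure_union_null ?_ ?_)
  · rintro ⟨a, b⟩ hab
    by_cases ha : a ∈ Ioo (0 : ℝ) 1
    · exact Or.inr fun hb => hab ⟨ha, hb⟩
    · exact Or.inl ha
  · rw [h.measure_preimage_fst hm, hz]
  · rw [h.measure_preimage_snd hm, hz]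

/-- On the set of points whose small balls satisfy P ≤ K · volume, the Vitali covering argument
gives the same inequality for all subsets. These sets, over K, cover the open square, which carries
P. -/
theorem absolutelyContinuous (h : IsCopulaLaw C P) (hg : IsAlternatingGenerator f g C) :
    P ≪ volume := by
  have := h.isProbabilityMeasure
  intro s hs
  set G : ℕ → Set (ℝ × ℝ) := fun K => {x | ∀ᶠ r in 𝓝[>] (0 : ℝ), P (Metric.closedBall x r) ≤
    ((K : NNReal) • (volume : Measure (ℝ × ℝ))) (Metric.closedBall x r)} with hG
  have hGnull : ∀ K, P (s ∩ G K) = 0 := by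
    intro K
    have h1 := (Besicovitch.vitaliFamily P).measure_le_of_frequently_le
      ((K : NNReal) • (volume : Measure (ℝ × ℝ))) Measure.AbsolutelyContinuous.rfl (s ∩ G K)
      fun x hx => (Besicovitch.tendsto_filterAt P x).frequently
        (Eventually.frequently (f := 𝓝[>] (0 : ℝ)) hx.2)
    refine le_antisymm (h1.trans ?_) zero_le
    rw [Measure.smul_apply, measure_mono_null inter_subset_left hs, smul_zero]
  refine measure_mono_null (t := (⋃ K, s ∩ G K) ∪ (Ioo (0 : ℝ) 1 ×ˢ Ioo (0 : ℝ) 1)ᶜ) ?_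
    (measure_union_null (measure_iUnion_null hGnull) h.measure_compl_unitSquare)
  rintro ⟨u, v⟩ hx
  by_cases huv : (u, v) ∈ Ioo (0 : ℝ) 1 ×ˢ Ioo (0 : ℝ) 1
  · obtain ⟨K, hK⟩ := h.exists_eventually_measure_closedBall_le hg huv.1 huv.2
    exact Or.inl (mem_iUnion.2 ⟨K, hx, hK⟩)
  · exact Or.inr huv

end IsCopulaLaw

/-! ### The grid on the unit square -/

/-- The half-open unit square. -/
def unitSquare : Set (ℝ × ℝ) := Ioc (0 : ℝ) 1 ×ˢ Ioc (0 : ℝ) 1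

theorem measurableSet_unitSquare : MeasurableSet unitSquare :=
  measurableSet_Ioc.prod measurableSet_Ioc

theorem volume_unitSquare : volume unitSquare = 1 := by
  rw [unitSquare, Measure.volume_eq_prod, Measure.prod_prod]
  simp

instance isProbabilityMeasure_volume_restrict_unitSquare :
    IsProbabilityMeasure ((volume : Measure (ℝ × ℝ)).restrict unitSquare) :=
  ⟨by rw [Measure.restrict_apply_univ, volume_unitSquare]⟩

/-- The index of the interval `(i / (n + 1), (i + 1) / (n + 1)]` that contains `u`, clamped to
the unit interval. -/
noncomputable def gridIndex (n : ℕ) (u : ℝ) : Fin (n + 1) :=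
  ⟨min (⌈u * (n + 1)⌉₊ - 1) n, Nat.lt_succ_of_le (min_le_right _ _)⟩

/-- Clamping at both ends keeps the index monotone on all of ℝ, as needed because supermodularity is
tested on the whole plane. -/
theorem monotone_gridIndex (n : ℕ) : Monotone (gridIndex n) := by
  intro u v huv
  have h1 : ⌈u * (n + 1)⌉₊ ≤ ⌈v * (n + 1)⌉₊ := Nat.ceil_mono (by gcongr)
  exact Fin.mk_le_mk.2 (min_le_min_right _ (Nat.sub_le_sub_right h1 1))

theorem measurable_gridIndex (n : ℕ) : Measurable (gridIndex n) :=
  (measurable_from_nat (f := fun k : ℕ => (⟨min (k - 1) n,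
    Nat.lt_succ_of_le (min_le_right _ _)⟩ : Fin (n + 1)))).comp
    (Nat.measurable_ceil.comp (measurable_id.mul_const _))

theorem gridIndex_eq_iff {n : ℕ} {u : ℝ} (hu : u ∈ Ioc (0 : ℝ) 1) (i : Fin (n + 1)) :
    gridIndex n u = i ↔ u ∈ Ioc ((i : ℝ) / (n + 1)) (((i : ℝ) + 1) / (n + 1)) := by
  have hn : (0 : ℝ) < n + 1 := by positivity
  have hpos : 0 < ⌈u * (n + 1)⌉₊ := Nat.ceil_pos.2 (mul_pos hu.1 hn)
  have hle : ⌈u * (n + 1)⌉₊ ≤ n + 1 := by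
    rw [Nat.ceil_le]
    push_cast
    nlinarith [hu.2]
  have h1 : gridIndex n u = i ↔ ⌈u * (n + 1)⌉₊ = i + 1 := by
    rw [gridIndex, Fin.ext_iff]
    simp only
    omega
  rw [h1, Nat.ceil_eq_iff (by omega), mem_Ioc, div_lt_iff₀ hn, le_div_iff₀ hn]
  simp

/-- A cell of the grid of mesh `1 / (n + 1)` on the unit square. -/
def gridCell (n : ℕ) (p : Fin (n + 1) × Fin (n + 1)) : Set (ℝ × ℝ) :=
  Ioc ((p.1 : ℝ) / (n + 1)) (((p.1 : ℝ) + 1) / (n + 1)) ×ˢ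
    Ioc ((p.2 : ℝ) / (n + 1)) (((p.2 : ℝ) + 1) / (n + 1))

/-- The cell that contains a point of the unit square. -/
noncomputable def gridPoint (n : ℕ) (x : ℝ × ℝ) : Fin (n + 1) × Fin (n + 1) :=
  (gridIndex n x.1, gridIndex n x.2)

theorem measurable_gridPoint (n : ℕ) : Measurable (gridPoint n) :=
  ((measurable_gridIndex n).comp measurable_fst).prodMk
    ((measurable_gridIndex n).comp measurable_snd)

theorem nonneg_div_grid (n : ℕ) (i : Fin (n + 1)) : 0 ≤ (i : ℝ) / (n + 1) := by positivity

theorem div_grid_lt (n : ℕ) (i : Fin (n + 1)) : (i : ℝ) / (n + 1) < ((i : ℝ) + 1) / (n + 1) := by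
  gcongr; linarith

theorem div_grid_le_one (n : ℕ) (i : Fin (n + 1)) : ((i : ℝ) + 1) / (n + 1) ≤ 1 := by
  rw [div_le_one (by positivity)]
  have : (i : ℕ) ≤ n := Nat.lt_succ_iff.1 i.2
  have : ((i : ℕ) : ℝ) ≤ n := by exact_mod_cast this
  linarith

theorem div_grid_le_of_lt {n : ℕ} {i j : Fin (n + 1)} (hij : i < j) :
    ((i : ℝ) + 1) / (n + 1) ≤ (j : ℝ) / (n + 1) := by
  have : ((i : ℕ) : ℝ) + 1 ≤ (j : ℕ) := by exact_mod_cast hij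
  gcongr

theorem gridPoint_preimage_inter (n : ℕ) (p : Fin (n + 1) × Fin (n + 1)) :
    gridPoint n ⁻¹' {p} ∩ unitSquare = gridCell n p := by
  have hsub : gridCell n p ⊆ unitSquare := prod_mono
    (Ioc_subset_Ioc (nonneg_div_grid n p.1) (div_grid_le_one n p.1))
    (Ioc_subset_Ioc (nonneg_div_grid n p.2) (div_grid_le_one n p.2))
  ext x
  constructor
  · rintro ⟨h1, h2⟩
    have h1' : gridPoint n x = p := h1
    exact ⟨(gridIndex_eq_iff h2.1 _).1 (congrArg Prod.fst h1'),
      (gridIndex_eq_iff h2.2 _).1 (congrArg Prod.snd h1')⟩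
  · intro h
    have h2 := hsub h
    exact ⟨Prod.ext ((gridIndex_eq_iff h2.1 _).2 h.1) ((gridIndex_eq_iff h2.2 _).2 h.2), h2⟩

theorem mem_gridCell_gridPoint (n : ℕ) {x : ℝ × ℝ} (hx : x ∈ unitSquare) :
    x ∈ gridCell n (gridPoint n x) :=
  gridPoint_preimage_inter n _ ▸ ⟨rfl, hx⟩

theorem volume_gridCell (n : ℕ) (p : Fin (n + 1) × Fin (n + 1)) :
    volume (gridCell n p) = ENNReal.ofReal (1 / ((n : ℝ) + 1) * (1 / ((n : ℝ) + 1))) := by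
  have h1 : ∀ i : Fin (n + 1), ((i : ℝ) + 1) / (n + 1) - (i : ℝ) / (n + 1) = 1 / ((n : ℝ) + 1) :=
    fun i => by ring
  rw [gridCell, Measure.volume_eq_prod, Measure.prod_prod, Real.volume_Ioc, Real.volume_Ioc, h1, h1,
    ENNReal.ofReal_mul (by positivity)]

theorem volume_restrict_real_gridCell (n : ℕ) (p : Fin (n + 1) × Fin (n + 1)) :
    ((volume : Measure (ℝ × ℝ)).restrict unitSquare).real (gridCell n p) =
      1 / ((n : ℝ) + 1) * (1 / ((n : ℝ) + 1)) := by
  rw [measureReal_def, Measure.restrict_apply' measurableSet_unitSquare,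
    inter_eq_left.2 (gridPoint_preimage_inter n p ▸ inter_subset_right), volume_gridCell,
    ENNReal.toReal_ofReal (by positivity)]

theorem integrable_comp_gridPoint (μ : Measure (ℝ × ℝ)) [IsFiniteMeasure μ] (n : ℕ)
    (F : Fin (n + 1) × Fin (n + 1) → ℝ) : Integrable (fun x => F (gridPoint n x)) μ :=
  (Integrable.of_finite (f := F)
    (μ := μ.map (gridPoint n))).comp_measurable (measurable_gridPoint n)

theorem integral_comp_gridPoint (μ : Measure (ℝ × ℝ)) [IsFiniteMeasure μ]
    (hμ : μ unitSquareᶜ = 0) (n : ℕ) (F : Fin (n + 1) × Fin (n + 1) → ℝ) :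
    ∫ x, F (gridPoint n x) ∂μ = ∑ p, μ.real (gridCell n p) * F p := by
  rw [← integral_map (measurable_gridPoint n).aemeasurable
    (Measurable.of_discrete (f := F)).aestronglyMeasurable, integral_fintype .of_finite]
  refine Finset.sum_congr rfl fun p _ => ?_
  rw [smul_eq_mul, map_measureReal_apply (measurable_gridPoint n) (measurableSet_singleton p),
    ← gridPoint_preimage_inter]
  congr 1
  exact (measureReal_congr (inter_ae_eq_left_of_ae_eq_univ
    (ae_eq_univ.2 hμ))).symm

theorem supermodular_of_monotone {α : Type*} [LinearOrder α] {m : ℝ → α} (hm : Monotone m)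
    {L : α × α → ℝ} (hL : ∀ i i' j j', i < i' → j < j' →
      L (i, j') + L (i', j) ≤ L (i, j) + L (i', j')) :
    Supermodular fun x => L (m x.1, m x.2) := by
  have hL' : ∀ i i' j j', i ≤ i' → j ≤ j' →
      L (i, j') + L (i', j) ≤ L (i, j) + L (i', j') := by
    intro i i' j j' hi hj
    rcases hi.eq_or_lt with rfl | hi
    · exact (add_comm _ _).le
    rcases hj.eq_or_lt with rfl | hj
    · exact le_rfl
    exact hL i i' j j' hi hj
  rintro ⟨a, b⟩ ⟨c, d⟩
  simp only [Prod.mk_sup_mk, Prod.mk_inf_mk]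
  rcases le_total a c with hac | hac <;> rcases le_total b d with hbd | hbd <;>
    simp only [hac, hbd, sup_of_le_left, sup_of_le_right, inf_of_le_left, inf_of_le_right]
  · exact (add_comm _ _).le
  · have := hL' _ _ _ _ (hm hac) (hm hbd)
    linarith
  · have := hL' _ _ _ _ (hm hac) (hm hbd)
    linarith
  · exact le_rfl

/-! ### Discretized densities: supermodularity and convergence -/

/-- The density of the discretization of `P` on the grid of mesh `1 / (n + 1)`. -/
noncomputable def gridDensity (P : Measure (ℝ × ℝ)) (n : ℕ)
    (p : Fin (n + 1) × Fin (n + 1)) : ℝ :=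
  ((n : ℝ) + 1) ^ 2 * P.real (gridCell n p)

namespace IsCopulaLaw

variable {C : ℝ → ℝ → ℝ} {P : Measure (ℝ × ℝ)} {f : ℕ → ℝ → ℝ} {g : ℝ → ℝ}

theorem measure_compl_halfOpen_unitSquare (h : IsCopulaLaw C P) : P unitSquareᶜ = 0 :=
  measure_mono_null (compl_subset_compl.2 (prod_mono Ioo_subset_Ioc_self Ioo_subset_Ioc_self))
    h.measure_compl_unitSquare

theorem restrict_unitSquare (h : IsCopulaLaw C P) : P.restrict unitSquare = P :=
  Measure.restrict_eq_self_of_ae_mem (mem_ae_iff.2 h.measure_compl_halfOpen_unitSquare)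

theorem gridDensity_pos (h : IsCopulaLaw C P) (hg : IsAlternatingGenerator f g C) (n : ℕ)
    (p : Fin (n + 1) × Fin (n + 1)) : 0 < gridDensity P n p :=
  mul_pos (by positivity) (h.measureReal_rectangle_pos hg (nonneg_div_grid n _) (div_grid_lt n _)
    (div_grid_le_one n _) (nonneg_div_grid n _) (div_grid_lt n _) (div_grid_le_one n _))

theorem supermodular_log_gridDensity (h : IsCopulaLaw C P) (hg : IsAlternatingGenerator f g C)
    (n : ℕ) : Supermodular fun x => Real.log (gridDensity P n (gridPoint n x)) := by
  refine supermodular_of_monotone (monotone_gridIndex n)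
    (L := fun p => Real.log (gridDensity P n p)) fun i i' j j' hi hj => ?_
  have hpos := h.gridDensity_pos hg n
  rw [← Real.log_mul (hpos _).ne' (hpos _).ne', ← Real.log_mul (hpos _).ne' (hpos _).ne']
  refine Real.log_le_log (mul_pos (hpos _) (hpos _)) ?_
  have key := h.measureReal_rectangle_mul_le hg (nonneg_div_grid n i) (div_grid_lt n i)
    (div_grid_le_of_lt hi) (div_grid_lt n i') (div_grid_le_one n i') (nonneg_div_grid n j)
    (div_grid_lt n j) (div_grid_le_of_lt hj) (div_grid_lt n j') (div_grid_le_one n j')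
  have h2 : (0 : ℝ) ≤ ((n : ℝ) + 1) ^ 2 * ((n : ℝ) + 1) ^ 2 := by positivity
  simp only [gridDensity, gridCell]
  calc _ = ((n : ℝ) + 1) ^ 2 * ((n : ℝ) + 1) ^ 2 * _ := by rw [mul_mul_mul_comm]
    _ ≤ ((n : ℝ) + 1) ^ 2 * ((n : ℝ) + 1) ^ 2 * _ := mul_le_mul_of_nonneg_left key h2
    _ = _ := by rw [mul_mul_mul_comm]

theorem integral_gridDensity (h : IsCopulaLaw C P) (n : ℕ) :
    ∫ x in unitSquare, gridDensity P n (gridPoint n x) = 1 := by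
  have := h.isProbabilityMeasure
  have hn : (n : ℝ) + 1 ≠ 0 := by positivity
  rw [integral_comp_gridPoint _ (by simp [measurableSet_unitSquare.compl])]
  have h1 := integral_comp_gridPoint P h.measure_compl_halfOpen_unitSquare n fun _ => 1
  simp only [integral_const, probReal_univ, smul_eq_mul, mul_one] at h1
  rw [h1]
  refine Finset.sum_congr rfl fun p _ => ?_
  rw [volume_restrict_real_gridCell, gridDensity]
  field_simp

/-- The added term 1 - c in `klFun` integrates to 0 over the square, and makes the integrand
nonnegative in view of Fatou's lemma. -/
theorem integral_log_gridDensity (h : IsCopulaLaw C P) (n : ℕ) :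
    ∫ x, Real.log (gridDensity P n (gridPoint n x)) ∂P =
      ∫ x in unitSquare, InformationTheory.klFun (gridDensity P n (gridPoint n x)) := by
  have := h.isProbabilityMeasure
  have hn : (n : ℝ) + 1 ≠ 0 := by positivity
  have h1 : ∫ x in unitSquare, InformationTheory.klFun (gridDensity P n (gridPoint n x)) =
      ∫ x in unitSquare, gridDensity P n (gridPoint n x) *
        Real.log (gridDensity P n (gridPoint n x)) := by
    simp only [InformationTheory.klFun_apply]
    rw [integral_sub, integral_add, h.integral_gridDensity]
    · simp
    · exact integrable_comp_gridPoint _ n fun p => gridDensity P n p * Real.log (gridDensity P n p)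
    · exact integrable_const _
    · exact integrable_comp_gridPoint _ n fun p =>
        gridDensity P n p * Real.log (gridDensity P n p) + 1
    · exact integrable_comp_gridPoint _ n fun p => gridDensity P n p
  rw [h1, integral_comp_gridPoint P h.measure_compl_halfOpen_unitSquare n
    fun p => Real.log (gridDensity P n p), integral_comp_gridPoint _
    (by simp [measurableSet_unitSquare.compl]) n
    fun p => gridDensity P n p * Real.log (gridDensity P n p)]
  refine Finset.sum_congr rfl fun p _ => ?_
  rw [volume_restrict_real_gridCell, ← mul_assoc]
  congr 1
  rw [gridDensity]
  field_simp

/-- Lebesgue differentiation: closed cells are sup-norm balls that contain x without being centred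
there, which the Vitali family of a doubling measure allows. The edges added by closing a cell are
P-null, the marginals being uniform. -/
theorem tendsto_gridDensity (h : IsCopulaLaw C P) :
    ∀ᵐ x ∂(volume : Measure (ℝ × ℝ)).restrict unitSquare,
      Tendsto (fun n => gridDensity P n (gridPoint n x)) atTop
        (𝓝 (P.rnDeriv volume x).toReal) := by
  have := h.isProbabilityMeasure
  rw [ae_restrict_iff' measurableSet_unitSquare]
  filter_upwards [(IsUnifLocDoublingMeasure.vitaliFamily (volume : Measure (ℝ × ℝ))
    1).ae_tendsto_rnDeriv P, P.rnDeriv_lt_top volume] with x hx hfin hxS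
  set r : ℕ → ℝ := fun n => 1 / ((n : ℝ) + 1) / 2 with hr
  set w : ℕ → ℝ × ℝ := fun n => (((gridPoint n x).1 : ℝ) / (n + 1) + r n,
    ((gridPoint n x).2 : ℝ) / (n + 1) + r n) with hw
  have hrlim : Tendsto r atTop (𝓝[>] 0) := by
    refine tendsto_nhdsWithin_iff.2 ⟨?_, Eventually.of_forall fun n => ?_⟩
    · have h0 := (tendsto_one_div_add_atTop_nhds_zero_nat (𝕜 := ℝ)).div_const 2
      rwa [zero_div] at h0
    · exact (by positivity : (0 : ℝ) < r n)
  have hball : ∀ n, Metric.closedBall (w n) (r n) =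
      Icc (((gridPoint n x).1 : ℝ) / (n + 1)) ((((gridPoint n x).1 : ℝ) + 1) / (n + 1)) ×ˢ
      Icc (((gridPoint n x).2 : ℝ) / (n + 1)) ((((gridPoint n x).2 : ℝ) + 1) / (n + 1)) := by
    intro n
    have e : ∀ a : ℝ, a / (n + 1) + r n + r n = (a + 1) / (n + 1) := fun a => by
      simp only [hr]; ring
    rw [hw, ← closedBall_prod_same, Real.closedBall_eq_Icc, Real.closedBall_eq_Icc,
      add_sub_cancel_right, add_sub_cancel_right, e, e]
  have hsub : ∀ n, gridCell n (gridPoint n x) ⊆ Metric.closedBall (w n) (r n) := fun n =>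
    hball n ▸ prod_mono Ioc_subset_Icc_self Ioc_subset_Icc_self
  have hP : ∀ n, P (Metric.closedBall (w n) (r n)) = P (gridCell n (gridPoint n x)) := by
    intro n
    refine le_antisymm ?_ (measure_mono (hsub n))
    have hline : ∀ a : ℝ, volume ({a} ∩ Icc (0 : ℝ) 1) = 0 := fun a =>
      measure_mono_null inter_subset_left (measure_singleton a)
    have h0 : P (Prod.fst ⁻¹' {((gridPoint n x).1 : ℝ) / (n + 1)} ∪
        Prod.snd ⁻¹' {((gridPoint n x).2 : ℝ) / (n + 1)}) = 0 := measure_union_null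
      (by rw [h.measure_preimage_fst (measurableSet_singleton _), hline])
      (by rw [h.measure_preimage_snd (measurableSet_singleton _), hline])
    rw [← add_zero (P (gridCell n _)), ← h0]
    refine (measure_mono ?_).trans (measure_union_le _ _)
    rw [hball]
    rintro ⟨a, b⟩ ⟨ha, hb⟩
    rcases ha.1.eq_or_lt with h1 | h1
    · exact Or.inr (Or.inl h1.symm)
    rcases hb.1.eq_or_lt with h2 | h2
    · exact Or.inr (Or.inr h2.symm)
    · exact Or.inl ⟨⟨h1, ha.2⟩, ⟨h2, hb.2⟩⟩
  have hvol : ∀ n, volume (Metric.closedBall (w n) (r n)) =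
      ENNReal.ofReal (1 / ((n : ℝ) + 1) * (1 / ((n : ℝ) + 1))) := by
    intro n
    have e : 2 * r n = 1 / ((n : ℝ) + 1) := by simp only [hr]; ring
    rw [hw, ← closedBall_prod_same, Measure.volume_eq_prod, Measure.prod_prod,
      Real.volume_closedBall, Real.volume_closedBall, e, ENNReal.ofReal_mul (by positivity)]
  have hlim := hx.comp (IsUnifLocDoublingMeasure.tendsto_closedBall_filterAt volume w r hrlim
    (K := 1) (Eventually.of_forall fun n => by
      rw [one_mul]; exact hsub n (mem_gridCell_gridPoint n hxS)))
  refine ((ENNReal.tendsto_toReal hfin.ne).comp hlim).congr fun n => ?_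
  have hn : (n : ℝ) + 1 ≠ 0 := by positivity
  rw [Function.comp_apply, Function.comp_apply, hP, hvol, ENNReal.toReal_div,
    ENNReal.toReal_ofReal (by positivity), gridDensity, measureReal_def]
  field_simp

end IsCopulaLaw

/-! ### Negative entropy as a divergence from the uniform law -/

/-- The Kullback–Leibler divergence of a law on the unit square from the uniform law. -/
noncomputable def uniformDivergence (P : Measure (ℝ × ℝ)) : ℝ≥0∞ :=
  ∫⁻ x in unitSquare, ENNReal.ofReal (InformationTheory.klFun (P.rnDeriv volume x).toReal)

/-- The pointwise form of Gibbs' inequality, from log (q / c) ≤ q / c - 1. -/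
theorem mul_log_add_one_sub_le_klFun {c q : ℝ} (hc : 0 ≤ c) (hq : 0 < q) :
    c * Real.log q + 1 - q ≤ InformationTheory.klFun c := by
  rw [InformationTheory.klFun_apply]
  rcases hc.eq_or_lt with rfl | hc
  · simp only [zero_mul]; linarith
  · have h1 := Real.log_le_sub_one_of_pos (div_pos hq hc)
    rw [Real.log_div hq.ne' hc.ne'] at h1
    have h2 := mul_le_mul_of_nonneg_left h1 hc.le
    have h3 : c * (q / c - 1) = q - c := by field_simp
    linarith

theorem neg_coe_sub_coe_add_coe (K : ℝ≥0∞) {B : ℝ≥0∞} (hB : B ≠ ⊤) :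
    -((B : EReal) - ((K : EReal) + (B : EReal))) = K := by
  lift B to NNReal using hB
  rcases eq_or_ne K ⊤ with rfl | hK
  · rfl
  · lift K to NNReal using hK
    have e : ∀ a : NNReal, (((a : ℝ≥0∞) : EReal)) = ((a : ℝ) : EReal) := fun _ => rfl
    rw [e, e, ← EReal.coe_add, ← EReal.coe_sub, ← EReal.coe_neg]
    congr 1; ring

theorem neg_copulaEntropy_of_absolutelyContinuous {P : Measure (ℝ × ℝ)} [IsProbabilityMeasure P]
    (hS : P unitSquareᶜ = 0) (hP : P ≪ volume) :
    -copulaEntropy P = (uniformDivergence P : EReal) := by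
  set c : ℝ × ℝ → ℝ := fun x => (P.rnDeriv volume x).toReal with hc
  have hcm : Measurable c := (P.measurable_rnDeriv volume).ennreal_toReal
  have hc0 : ∀ᵐ x ∂(volume : Measure (ℝ × ℝ)).restrict unitSquareᶜ, P.rnDeriv volume x = 0 := by
    refine (lintegral_eq_zero_iff (P.measurable_rnDeriv volume) (μ := volume.restrict unitSquareᶜ)).1 ?_
    rw [Measure.setLIntegral_rnDeriv hP, hS]
  have hrestrict : ∀ F : ℝ → ℝ≥0∞, F 0 = 0 → ∫⁻ x, F (c x) = ∫⁻ x in unitSquare, F (c x) := by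
    intro F hF
    rw [← lintegral_add_compl _ measurableSet_unitSquare]
    have : ∫⁻ x in unitSquareᶜ, F (c x) = 0 := by
      rw [← lintegral_zero (μ := (volume : Measure (ℝ × ℝ)).restrict unitSquareᶜ)]
      refine lintegral_congr_ae ?_
      filter_upwards [hc0] with x hx
      simp [hc, hx, hF]
    rw [this, add_zero]
  set A := ∫⁻ x in unitSquare, ENNReal.ofReal (-Real.negMulLog (c x)) with hA
  set B := ∫⁻ x in unitSquare, ENNReal.ofReal (Real.negMulLog (c x)) with hB
  have hH : copulaEntropy P = (B : EReal) - (A : EReal) := by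
    rw [copulaEntropy, if_pos hP, hA, hB,
      ← hrestrict (fun t => ENNReal.ofReal (-Real.negMulLog t)) (by simp),
      ← hrestrict (fun t => ENNReal.ofReal (Real.negMulLog t)) (by simp)]
  -- Nonnegativity of `klFun` reads -c log c ≤ 1 - c ≤ 1.
  have hBfin : B ≠ ⊤ := by
    refine ne_top_of_le_ne_top ENNReal.one_ne_top ?_
    calc B ≤ ∫⁻ _ in unitSquare, 1 := by
          refine lintegral_mono fun x => ?_
          have h0 : 0 ≤ c x := ENNReal.toReal_nonneg
          have h1 := InformationTheory.klFun_nonneg h0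
          rw [InformationTheory.klFun_apply] at h1
          rw [ENNReal.ofReal_le_one, Real.negMulLog]
          linarith
      _ = 1 := by rw [lintegral_one, measure_univ]
  have hmass : ∫⁻ x in unitSquare, ENNReal.ofReal (c x) = 1 := by
    calc ∫⁻ x in unitSquare, ENNReal.ofReal (c x) = ∫⁻ x in unitSquare, P.rnDeriv volume x := by
          refine lintegral_congr_ae ?_
          filter_upwards [ae_restrict_of_ae (P.rnDeriv_lt_top volume)] with x hx
          exact ENNReal.ofReal_toReal hx.ne
      _ = P unitSquare := Measure.setLIntegral_rnDeriv hP _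
      _ = 1 := (prob_compl_eq_zero_iff measurableSet_unitSquare).1 hS
  -- Integrates klFun c + (-c log c)⁺ + c = (c log c)⁺ + 1, arranged without subtraction since the
  -- divergence may be infinite.
  have hsum : uniformDivergence P + B + 1 = A + 1 := by
    have hm : Measurable fun x => Real.negMulLog (c x) :=
      Real.continuous_negMulLog.measurable.comp hcm
    have h1 : uniformDivergence P + B + ∫⁻ x in unitSquare, ENNReal.ofReal (c x) =
        A + ∫⁻ _ in unitSquare, 1 := by
      rw [uniformDivergence, hA, hB, ← lintegral_add_right _ hm.ennreal_ofReal,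
        ← lintegral_add_right _ hcm.ennreal_ofReal, ← lintegral_add_right _ measurable_const]
      refine lintegral_congr fun x => ?_
      have h0 : 0 ≤ c x := ENNReal.toReal_nonneg
      have hk := InformationTheory.klFun_nonneg h0
      have hk' : InformationTheory.klFun (c x) = -Real.negMulLog (c x) + 1 - c x := by
        rw [InformationTheory.klFun_apply, Real.negMulLog]; ring
      change ENNReal.ofReal (InformationTheory.klFun (c x)) + _ + _ = _
      rcases le_total 0 (Real.negMulLog (c x)) with hn | hn
      · rw [← ENNReal.ofReal_add hk hn, ← ENNReal.ofReal_add (add_nonneg hk hn) h0,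
          ENNReal.ofReal_of_nonpos (neg_nonpos.2 hn), zero_add, ← ENNReal.ofReal_one, hk']
        congr 1; ring
      · rw [ENNReal.ofReal_of_nonpos hn, add_zero, ← ENNReal.ofReal_add hk h0,
          ← ENNReal.ofReal_one, ← ENNReal.ofReal_add (neg_nonneg.2 hn) zero_le_one, hk']
        congr 1; ring
    rwa [hmass, lintegral_one, measure_univ] at h1
  have hA' : A = uniformDivergence P + B := ((ENNReal.add_left_inj ENNReal.one_ne_top).1 hsum).symm
  rw [hH, hA', EReal.coe_ennreal_add]
  exact neg_coe_sub_coe_add_coe _ hBfin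

/-! ### Gibbs' inequality and passage to the limit -/

namespace IsCopulaLaw

variable {C D : ℝ → ℝ → ℝ} {P Q : Measure (ℝ × ℝ)} {f : ℕ → ℝ → ℝ} {g : ℝ → ℝ}

/-- Gibbs' inequality for Q against the discretized density of P, which has total mass 1. -/
theorem ofReal_integral_log_gridDensity_le (h : IsCopulaLaw C P)
    (hg : IsAlternatingGenerator f g C) (hQ : IsCopulaLaw D Q) (hQac : Q ≪ volume) (n : ℕ) :
    ENNReal.ofReal (∫ x, Real.log (gridDensity P n (gridPoint n x)) ∂Q) ≤
      uniformDivergence Q := by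
  have := hQ.isProbabilityMeasure
  rcases eq_or_ne (uniformDivergence Q) ⊤ with htop | hfin
  · exact htop ▸ le_top
  have hm : Measurable fun x => InformationTheory.klFun (Q.rnDeriv volume x).toReal :=
    InformationTheory.measurable_klFun.comp (Q.measurable_rnDeriv volume).ennreal_toReal
  have hnn : ∀ x, 0 ≤ InformationTheory.klFun (Q.rnDeriv volume x).toReal := fun x =>
    InformationTheory.klFun_nonneg ENNReal.toReal_nonneg
  have hint : IntegrableOn (fun x => InformationTheory.klFun (Q.rnDeriv volume x).toReal)
      unitSquare := by
    refine (lintegral_ofReal_ne_top_iff_integrable hm.aestronglyMeasurable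
      (ae_of_all _ hnn)).1 hfin
  rw [uniformDivergence, ← ofReal_integral_eq_lintegral_ofReal hint (ae_of_all _ hnn)]
  refine ENNReal.ofReal_le_ofReal ?_
  have hi1 : IntegrableOn (fun x => (Q.rnDeriv volume x).toReal *
      Real.log (gridDensity P n (gridPoint n x))) unitSquare :=
    ((integrable_rnDeriv_smul_iff hQac).2
      (integrable_comp_gridPoint Q n fun p => Real.log (gridDensity P n p))).integrableOn
  have hi2 : IntegrableOn (fun x => gridDensity P n (gridPoint n x)) unitSquare :=
    integrable_comp_gridPoint _ n fun p => gridDensity P n p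
  have hi3 : IntegrableOn (fun x => (Q.rnDeriv volume x).toReal *
      Real.log (gridDensity P n (gridPoint n x)) + 1) unitSquare :=
    hi1.add (integrable_const _)
  calc ∫ x, Real.log (gridDensity P n (gridPoint n x)) ∂Q
      = ∫ x in unitSquare, ((Q.rnDeriv volume x).toReal *
          Real.log (gridDensity P n (gridPoint n x)) + 1 - gridDensity P n (gridPoint n x)) := by
        rw [integral_sub hi3 hi2,
          integral_add hi1 (integrable_const _), h.integral_gridDensity,
          setIntegral_toReal_rnDeriv_mul hQac measurableSet_unitSquare, hQ.restrict_unitSquare]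
        simp
    _ ≤ _ := integral_mono (hi3.sub hi2) hint fun x =>
        mul_log_add_one_sub_le_klFun ENNReal.toReal_nonneg (h.gridDensity_pos hg n _)

/-- For each n the discretized divergence of P is E_P log p_n ≤ E_Q log p_n, by the supermodular
order, and the latter is at most the divergence of Q. Fatou's lemma then lets n → ∞. -/
theorem uniformDivergence_le (h : IsCopulaLaw C P) (hg : IsAlternatingGenerator f g C)
    (hQ : IsCopulaLaw D Q) (hQac : Q ≪ volume) (hSM : SMOrder P Q) :
    uniformDivergence P ≤ uniformDivergence Q := by
  have := h.isProbabilityMeasure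
  have := hQ.isProbabilityMeasure
  have hm : ∀ n, Measurable fun x =>
      ENNReal.ofReal (InformationTheory.klFun (gridDensity P n (gridPoint n x))) := fun n =>
    ((Measurable.of_discrete (f := fun p => InformationTheory.klFun (gridDensity P n p))).comp
      (measurable_gridPoint n)).ennreal_ofReal
  have hbound : ∀ n, ∫⁻ x in unitSquare,
      ENNReal.ofReal (InformationTheory.klFun (gridDensity P n (gridPoint n x))) ≤
        uniformDivergence Q := by
    intro n
    rw [← ofReal_integral_eq_lintegral_ofReal
      (integrable_comp_gridPoint _ n fun p => InformationTheory.klFun (gridDensity P n p))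
      (ae_of_all _ fun x => InformationTheory.klFun_nonneg (h.gridDensity_pos hg n _).le),
      ← h.integral_log_gridDensity]
    refine (ENNReal.ofReal_le_ofReal (hSM _ (h.supermodular_log_gridDensity hg n) ?_ ?_)).trans
      (h.ofReal_integral_log_gridDensity_le hg hQ hQac n)
    · exact integrable_comp_gridPoint _ n fun p => Real.log (gridDensity P n p)
    · exact integrable_comp_gridPoint _ n fun p => Real.log (gridDensity P n p)
  calc uniformDivergence P
      = ∫⁻ x in unitSquare, liminf (fun n => ENNReal.ofReal
          (InformationTheory.klFun (gridDensity P n (gridPoint n x)))) atTop := by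
        refine lintegral_congr_ae ?_
        filter_upwards [h.tendsto_gridDensity] with x hx
        exact (ENNReal.tendsto_ofReal
          ((InformationTheory.continuous_klFun.tendsto _).comp hx)).liminf_eq.symm
    _ ≤ liminf (fun n => ∫⁻ x in unitSquare, ENNReal.ofReal
          (InformationTheory.klFun (gridDensity P n (gridPoint n x)))) atTop :=
        lintegral_liminf_le hm
    _ ≤ uniformDivergence Q := liminf_le_of_le (by isBoundedDefault) fun b hb =>
        let ⟨n, hn⟩ := hb.exists; hn.trans (hbound n)

end IsCopulaLaw

theorem mainTheorem4
    (Θ : Set ℝ) (δ : ℝ) (ψ φ : ℝ → ℝ → ℝ) (P : ℝ → Measure (ℝ × ℝ))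
    (hψ : ∀ θ ∈ Θ, IsLaplaceTransform (ψ θ))
    (hφ : IsArchimedeanGenerator (φ δ))
    (hP : ∀ θ ∈ Θ, IsCopulaLaw (twoParameterCopula (ψ θ) (φ δ)) (P θ))
    (hη : ∀ θ ∈ Θ, IsCompletelyMonotone (twoParameterGenerator (ψ θ) (φ δ)))
    (hη0 : ∀ θ ∈ Θ, twoParameterGenerator (ψ θ) (φ δ) 0 = 1)
    (hSM : ∀ θ₁ ∈ Θ, ∀ θ₂ ∈ Θ, θ₁ ≤ θ₂ → SMOrder (P θ₁) (P θ₂)) :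
    MonotoneOn (fun θ => -copulaEntropy (P θ)) Θ := by
  intro θ₁ h₁ θ₂ h₂ hle
  obtain ⟨f₁, g₁, hg₁⟩ := exists_isAlternatingGenerator (hψ θ₁ h₁) hφ (hη θ₁ h₁)
  obtain ⟨f₂, g₂, hg₂⟩ := exists_isAlternatingGenerator (hψ θ₂ h₂) hφ (hη θ₂ h₂)
  have hP₁ := hP θ₁ h₁
  have hP₂ := hP θ₂ h₂
  have := hP₁.isProbabilityMeasure
  have := hP₂.isProbabilityMeasure
  have hac₂ := hP₂.absolutelyContinuous hg₂
  simp only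
  rw [neg_copulaEntropy_of_absolutelyContinuous hP₁.measure_compl_halfOpen_unitSquare
      (hP₁.absolutelyContinuous hg₁),
    neg_copulaEntropy_of_absolutelyContinuous hP₂.measure_compl_halfOpen_unitSquare hac₂]
  exact EReal.coe_ennreal_le_coe_ennreal_iff.2
    (hP₁.uniformDivergence_le hg₁ hP₂ hac₂ (hSM θ₁ h₁ θ₂ h₂ hle))
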